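/- **Setting.** Let $N\ge 0$ be an integer, $x_1,\dots,x_N\in\mathbb R^3$, $\beta=(\beta_1,\beta_2,\beta_3)\in\mathbb R^3$, and let $\chi\in\mathcal S(\mathbb R)$ be real valued. Let $H$ be the real Hilbert space of $f\in L^2(\mathbb R^3;\mathbb R^3)$ with $k\cdot f(k)=0$ for a.e. $k$, let $H_{\mathbb C}$ be its complexification, let $\mathcal H_{ph}=\mathcal F_s(H_{\mathbb C})$ be the symmetric Fock space and $\mathcal H_{sp}=(\mathbb C^2)^{\otimes N}$. Inner products $\langle\cdot,\cdot\rangle$ on $\mathcal H_{sp}$ are linear in the first argument. Let $M$ be multiplication by $|k|$ in $H$, with maximal domain $D(M)$. With the canonical basis $(e_1,e_2,e_3)$ of $\mathbb R^3$ define, for $x\in\mathbb R^3$ and $m=1,2,3$, the elements of $H$ $$a_m(x)(k)=\frac{\chi(|k|)|k|^{1/2}}{(2\pi)^{3/2}}\sin(k\cdot x)\frac{k\wedge e_m}{|k|},\qquad b_m(x)(k)=\frac{\chi(|k|)|k|^{1/2}}{(2\pi)^{3/2}}\cos(k\cdot x)\frac{k\wedge e_m}{|k|},$$ and for $(q,p)\in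 H^2$ put $B_m(x,q,p)=a_m(x)\cdot q+b_m(x)\cdot p$. For $h>0$ let $H_{ph}=h\,\mathrm d\Gamma(M)$ and $B_m(x)=\sqrt h\,\Phi_S(a_m(x)+ib_m(x))$ be operators in $\mathcal H_{ph}$, where $\Phi_S(g)=(a(g)+a^*(g))/\sqrt2$ is the (selfadjoint) Segal field, and let $$\Psi_{q,p,h}=\sum_{n\ge0}\frac{e^{-(|q|^2+|p|^2)/(4h)}}{(2h)^{n/2}\sqrt{n!}}\,(q+ip)^{\otimes n}\in\mathcal H_{ph}$$ be the coherent state. Let $\sigma_1,\sigma_2,\sigma_3$ be the Pauli matrices, and let $\sigma_m^{[\lambda]}$ act as $\sigma_m$ on the $\lambda$-th factor of $\mathcal H_{sp}$ and as the identity on the others. Define in $\mathcal H_{ph}\otimes\mathcal H_{sp}$ the operator $$H(h)=H_{ph}\otimes I+h\sum_{\lambda=1}^N\sum_{m=1}^3(\beta_m+B_m(x_\lambda))\otimes\sigma_m^{[\lambda]}.$$ Let $\mathcal G$ be the Lie algebra of traceless antihermitian operators on $\mathcal H_{sp}$; for a unit vector $a\in\mathcal H_{sp}$ let $\pi_a\in\mathcal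 G^*$ be given by $\langle\pi_a,Y\rangle=i^{-1}\langle Ya,a\rangle$. Define, for $\omega\in\mathcal G^*$, $$H(q,p,\omega)=\frac12\int_{\mathbb R^3}|k|\,(|q(k)|^2+|p(k)|^2)\,dk+h\sum_{\lambda=1}^N\sum_{m=1}^3(\beta_m+B_m(x_\lambda,q,p))\langle\omega,i\sigma_m^{[\lambda]}\rangle .$$ The Hamiltonian system is $$q'=Mp+h\sum_{\lambda,m}b_m(x_\lambda)\langle\omega,i\sigma_m^{[\lambda]}\rangle,\qquad p'=-Mq-h\sum_{\lambda,m}a_m(x_\lambda)\langle\omega,i\sigma_m^{[\lambda]}\rangle,$$ $$\frac{d}{dt}\langle\omega,Y\rangle=\sum_{\lambda,m}(\beta_m+B_m(x_\lambda,q,p))\langle\omega,[i\sigma_m^{[\lambda]},Y]\rangle\quad(Y\in\mathcal G).$$ A point $(q,p,\omega)$ is *stationary* if the constant curve equal to it is a solution (in particular $q,p\in D(M)$). **Proposition 6.4.** (i) Let $h>0$, $(q,p)\in H^2$ and let $a\in\mathcal H_{sp}$ be a unit vector such that $(q,p,\pi_a)$ is a stationary point of the Hamiltonian system. Then $\Psi_{q,p,h}\neq0$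 belongs to the domain of the operator below, and $$\Big[H_{ph}+h\sum_{\lambda=1}^N\sum_{m=1}^3(\beta_m+B_m(x_\lambda))\langle\sigma_m^{[\lambda]}a,a\rangle\Big]\Psi_{q,p,h}=H(q,p,\pi_a)\,\Psi_{q,p,h}.$$ (ii) Suppose $\beta\ne0$. For every $h_0>0$ there is a constant $C>0$, depending only on $h_0,N,\chi,\beta$ and $x_1,\dots,x_N$, with the following property. Let $b_0,b_1\in\mathbb C^2$ be unit vectors with $\sum_m\beta_m\sigma_mb_0=-|\beta|b_0$ and $\sum_m\beta_m\sigma_mb_1=|\beta|b_1$, and for $E\subset\{1,\dots,N\}$ let $a_E=a_1\otimes\cdots\otimes a_N$ with $a_j=b_1$ if $j\in E$ and $a_j=b_0$ if $j\notin E$. Then for all $h\in(0,h_0]$, all $(q,p)\in H^2$ and unit vectors $a\in\mathcal H_{sp}$ such that $(q,p,\pi_a)$ is a stationary point of the Hamiltonian system (with this $h$), and all $E\subset\{1,\dots,N\}$, the vector $\Psi_{q,p,h}\otimes a_E$ belongs to the domain of $H(h)$ and $$\big\|\big(H(h)-(2|E|-N)|\beta|h\big)(\Psi_{q,p,h}\otimes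 a_E)\big\|\le C\,h^{3/2}.$$ -/

import Mathlib

open MeasureTheory
open scoped TensorProduct SchwartzMap Matrix

noncomputable section

namespace SpinPhoton

/-! ### One-particle space -/

/-- The momentum space `ℝ³` (also used for positions and for the constant magnetic field). -/
abbrev R3 : Type := EuclideanSpace ℝ (Fin 3)

/-- The vector space `ℂ³`. -/
abbrev C3 : Type := EuclideanSpace ℂ (Fin 3)

/-- The real Hilbert space `H` of (classes of) square integrable fields `f : ℝ³ → ℝ³` with
`k · f(k) = 0` for almost every `k`. -/
def HReal : Submodule ℝ (Lp R3 2 (volume : Measure R3)) where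
  carrier := {f | ∀ᵐ k : R3, inner ℝ k (f k) = 0}
  add_mem' := by
    intro f g hf hg
    filter_upwards [hf, hg, Lp.coeFn_add f g] with k h1 h2 h3
    rw [h3, Pi.add_apply, inner_add_right, h1, h2, add_zero]
  zero_mem' := by
    filter_upwards [Lp.coeFn_zero R3 2 (volume : Measure R3)] with k h1
    rw [h1, Pi.zero_apply, inner_zero_right]
  smul_mem' := by
    intro c f hf
    filter_upwards [hf, Lp.coeFn_smul c f] with k h1 h2
    rw [h2, Pi.smul_apply, inner_smul_right, h1, mul_zero]

/-- The multiplication operator `M` by `ω(k) = |k|` in `H`, with its maximal domain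
`D(M) = {f ∈ H : |k| f ∈ H}`; it is given through its graph. -/
def freqMulGraph : Submodule ℝ (HReal × HReal) where
  carrier := {P | ∀ᵐ k : R3, (P.2 : Lp R3 2 (volume : Measure R3)) k =
    ‖k‖ • (P.1 : Lp R3 2 (volume : Measure R3)) k}
  add_mem' := by
    intro P Q hP hQ
    filter_upwards [hP, hQ, Lp.coeFn_add P.1.1 Q.1.1, Lp.coeFn_add P.2.1 Q.2.1] with k h1 h2 h3 h4
    simp only [Prod.fst_add, Prod.snd_add, Submodule.coe_add, h3, h4, Pi.add_apply, h1, h2,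
      smul_add]
  zero_mem' := by
    filter_upwards [Lp.coeFn_zero R3 2 (volume : Measure R3)] with k h1
    simp only [Prod.fst_zero, Prod.snd_zero, Submodule.coe_zero]
    rw [h1, Pi.zero_apply, smul_zero]
  smul_mem' := by
    intro c P hP
    filter_upwards [hP, Lp.coeFn_smul c P.1.1, Lp.coeFn_smul c P.2.1] with k h1 h3 h4
    simp only [Prod.smul_fst, Prod.smul_snd, Submodule.coe_smul, h3, h4, Pi.smul_apply, h1]
    rw [smul_comm]

lemma freqMulGraph_functional (P : HReal × HReal) (hP : P ∈ freqMulGraph) (h0 : P.1 = 0) :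
    P.2 = 0 := by
  apply Subtype.ext
  apply Lp.ext
  have hP' : ∀ᵐ k : R3, (P.2 : Lp R3 2 (volume : Measure R3)) k =
    ‖k‖ • (P.1 : Lp R3 2 (volume : Measure R3)) k := hP
  rw [h0] at hP'
  filter_upwards [hP', Lp.coeFn_zero R3 2 (volume : Measure R3)] with k h1 h2
  rw [h1, ZeroMemClass.coe_zero, h2, Pi.zero_apply, smul_zero]

/-- The operator `M` in `H`. -/
def freqMul : HReal →ₗ.[ℝ] HReal := freqMulGraph.toLinearPMap

/-- The embedding of `ℝ³` into `ℂ³`. -/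
def complexify : R3 →L[ℝ] C3 :=
  LinearMap.toContinuousLinearMap
    { toFun := fun v => WithLp.toLp 2 (fun i => ((v i : ℝ) : ℂ))
      map_add' := by intro v w; ext i; simp
      map_smul' := by intro c v; ext i; simp }

/-- The element `q + i p` of the complexification of `H`, realized as a `ℂ³`-valued square
integrable field. -/
def cplx (q p : HReal) : Lp C3 2 (volume : Measure R3) :=
  complexify.compLpL 2 (volume : Measure R3) (q : Lp R3 2 (volume : Measure R3)) +
    Complex.I • complexify.compLpL 2 (volume : Measure R3) (p : Lp R3 2 (volume : Measure R3))

/-! ### Fock space -/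

/-- `L²((ℝ³)ⁿ ; (ℂ³)^{⊗ n})`, a vector of `(ℂ³)^{⊗ n}` being given by its coordinates indexed
by `Fin n → Fin 3`. It is the `n`-th Hilbert tensor power of `L²(ℝ³; ℂ³)`. -/
abbrev TensorL2 (n : ℕ) : Type :=
  Lp (EuclideanSpace ℂ (Fin n → Fin 3)) 2 (volume : Measure (Fin n → R3))

/-- The tensor product of a vector of `ℂ³` and a vector of `(ℂ³)^{⊗ n}`. -/
def tensVec (n : ℕ) (v : C3) (w : EuclideanSpace ℂ (Fin n → Fin 3)) :
    EuclideanSpace ℂ (Fin (n + 1) → Fin 3) :=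
  WithLp.toLp 2 (fun c => v (c 0) * w (Fin.tail c))

lemma norm_tensVec (n : ℕ) (v : C3) (w : EuclideanSpace ℂ (Fin n → Fin 3)) :
    ‖tensVec n v w‖ = ‖v‖ * ‖w‖ := by
  have h : ‖tensVec n v w‖ ^ 2 = (‖v‖ * ‖w‖) ^ 2 := by
    rw [mul_pow, EuclideanSpace.norm_sq_eq, EuclideanSpace.norm_sq_eq, EuclideanSpace.norm_sq_eq,
      Finset.sum_mul_sum, ← Finset.sum_product']
    symm
    apply Fintype.sum_equiv (Fin.consEquiv (fun _ : Fin (n + 1) => Fin 3))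
    rintro ⟨i, c⟩
    have hc : Fin.tail ((Fin.consEquiv fun _ : Fin (n + 1) => Fin 3) (i, c)) = c := rfl
    simp [tensVec, mul_pow, hc]
  exact (pow_left_inj₀ (norm_nonneg _) (by positivity) two_ne_zero).1 h

lemma continuous_tensVec (n : ℕ) :
    Continuous (fun P : C3 × EuclideanSpace ℂ (Fin n → Fin 3) => tensVec n P.1 P.2) := by
  unfold tensVec
  fun_prop

lemma qmp_head (n : ℕ) : Measure.QuasiMeasurePreserving (fun k : Fin (n + 1) → R3 => k 0) :=
  Measure.quasiMeasurePreserving_eval _ 0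

lemma qmp_tail (n : ℕ) :
    Measure.QuasiMeasurePreserving (fun k : Fin (n + 1) → R3 => Fin.tail k) := by
  have h := (volume_preserving_piFinSuccAbove (fun _ : Fin (n + 1) => R3) 0)
  exact Measure.quasiMeasurePreserving_snd.comp h.quasiMeasurePreserving

/-- The function `(k₀, …, kₙ) ↦ g(k₀) ⊗ ψ(k₁, …, kₙ)`. -/
def tensFun (n : ℕ) (g : Lp C3 2 (volume : Measure R3)) (ψ : TensorL2 n) (k : Fin (n + 1) → R3) :
    EuclideanSpace ℂ (Fin (n + 1) → Fin 3) :=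
  tensVec n (g (k 0)) (ψ (Fin.tail k))

lemma aestronglyMeasurable_tensFun (n : ℕ) (g : Lp C3 2 (volume : Measure R3)) (ψ : TensorL2 n) :
    AEStronglyMeasurable (tensFun n g ψ) volume := by
  have h1 := (Lp.aestronglyMeasurable g).comp_quasiMeasurePreserving (qmp_head n)
  have h2 := (Lp.aestronglyMeasurable ψ).comp_quasiMeasurePreserving (qmp_tail n)
  exact (continuous_tensVec n).comp_aestronglyMeasurable (h1.prodMk h2)

lemma eLpNorm_tensFun (n : ℕ) (g : Lp C3 2 (volume : Measure R3)) (ψ : TensorL2 n) :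
    eLpNorm (tensFun n g ψ) 2 volume = eLpNorm g 2 volume * eLpNorm ψ 2 volume := by
  rw [eLpNorm_eq_lintegral_rpow_enorm_toReal two_ne_zero ENNReal.ofNat_ne_top,
    eLpNorm_eq_lintegral_rpow_enorm_toReal two_ne_zero ENNReal.ofNat_ne_top,
    eLpNorm_eq_lintegral_rpow_enorm_toReal two_ne_zero ENNReal.ofNat_ne_top,
    ← ENNReal.mul_rpow_of_nonneg _ _ (by positivity)]
  congr 1
  have h := (volume_preserving_piFinSuccAbove (fun _ : Fin (n + 1) => R3) 0)
  have h3 : ∀ k : Fin (n + 1) → R3, ‖tensFun n g ψ k‖ₑ ^ (ENNReal.toReal 2) =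
      (fun P : R3 × (Fin n → R3) => ‖g P.1‖ₑ ^ (ENNReal.toReal 2) *
        ‖ψ P.2‖ₑ ^ (ENNReal.toReal 2))
        (MeasurableEquiv.piFinSuccAbove (fun _ : Fin (n + 1) => R3) 0 k) := by
    intro k
    have h4 : ‖tensFun n g ψ k‖ₑ = ‖g (k 0)‖ₑ * ‖ψ (Fin.tail k)‖ₑ := by
      rw [← ofReal_norm, ← ofReal_norm, ← ofReal_norm, tensFun, norm_tensVec,
        ENNReal.ofReal_mul (norm_nonneg _)]
    rw [h4, ENNReal.mul_rpow_of_nonneg _ _ (by positivity)]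
    rfl
  rw [lintegral_congr h3]
  refine (h.lintegral_comp_emb (MeasurableEquiv.measurableEmbedding _)
    (fun P : R3 × (Fin n → R3) => ‖g P.1‖ₑ ^ (ENNReal.toReal 2) *
        ‖ψ P.2‖ₑ ^ (ENNReal.toReal 2))).trans ?_
  exact lintegral_prod_mul ((Lp.aestronglyMeasurable g).enorm.pow_const _)
    ((Lp.aestronglyMeasurable ψ).enorm.pow_const _)

lemma memLp_tensFun (n : ℕ) (g : Lp C3 2 (volume : Measure R3)) (ψ : TensorL2 n) :
    MemLp (tensFun n g ψ) 2 volume := by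
  refine ⟨aestronglyMeasurable_tensFun n g ψ, ?_⟩
  rw [eLpNorm_tensFun]
  exact ENNReal.mul_lt_top (Lp.eLpNorm_lt_top g) (Lp.eLpNorm_lt_top ψ)

/-- The bounded operator `ψ ↦ g ⊗ ψ`. -/
def tens (n : ℕ) (g : Lp C3 2 (volume : Measure R3)) : TensorL2 n →L[ℂ] TensorL2 (n + 1) :=
  LinearMap.mkContinuous
    { toFun := fun ψ => (memLp_tensFun n g ψ).toLp (tensFun n g ψ)
      map_add' := by
        intro ψ φ
        rw [← MemLp.toLp_add]
        apply MemLp.toLp_congr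
        filter_upwards [(qmp_tail n).ae (Lp.coeFn_add ψ φ)] with k hk
        ext c
        simp only [tensFun, tensVec]
        rw [hk]
        simp [mul_add, tensFun, tensVec]
      map_smul' := by
        intro z ψ
        rw [RingHom.id_apply, ← MemLp.toLp_const_smul]
        apply MemLp.toLp_congr
        filter_upwards [(qmp_tail n).ae (Lp.coeFn_smul z ψ)] with k hk
        ext c
        simp only [tensFun, tensVec]
        rw [hk]
        simp [tensFun, tensVec, mul_left_comm] }
    ‖g‖
    (by
      intro ψ
      simp only [LinearMap.coe_mk, AddHom.coe_mk]
      rw [Lp.norm_toLp, eLpNorm_tensFun, ENNReal.toReal_mul, Lp.norm_def, Lp.norm_def])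

lemma norm_tens_le (n : ℕ) (g : Lp C3 2 (volume : Measure R3)) (ψ : TensorL2 n) :
    ‖tens n g ψ‖ ≤ ‖g‖ * ‖ψ‖ :=
  (tens n g).le_of_opNorm_le (LinearMap.mkContinuous_norm_le _ (norm_nonneg _) _) ψ

/-- The constant function `1`, as an element of the `0`-th tensor power (which is `ℂ`). -/
def vac : TensorL2 0 :=
  (memLp_const (μ := (volume : Measure (Fin 0 → R3)))
    (WithLp.toLp 2 (fun _ => 1) : EuclideanSpace ℂ (Fin 0 → Fin 3))).toLp _

/-- The tensor power `f ⊗ ⋯ ⊗ f`. -/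
def tensPow (f : Lp C3 2 (volume : Measure R3)) : (n : ℕ) → TensorL2 n
  | 0 => vac
  | n + 1 => tens n f (tensPow f n)

/-- The `n`-particle space: the completion of the `n`-fold symmetric tensor product of the
complexification of `H`, that is, by polarization, the closed linear span of the tensor powers
`(q + i p)^{⊗ n}`, `q, p ∈ H`. -/
def symPow (n : ℕ) : Submodule ℂ (TensorL2 n) :=
  (Submodule.span ℂ {ψ | ∃ q p : HReal, ψ = tensPow (cplx q p) n}).topologicalClosure

instance instCompleteSpaceSymPow (n : ℕ) : CompleteSpace (symPow n) :=
  (Submodule.isClosed_topologicalClosure _).completeSpace_coe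

/-- The symmetric Fock space over the complexification of `H`: the Hilbert direct sum of the
`n`-particle spaces. -/
abbrev Fock : Type := lp (fun n => symPow n) 2

/-- Second quantization `dΓ(M)` of the multiplication by `|k|`: multiplication by
`|k₁| + ⋯ + |kₙ|` on the `n`-particle space, with its maximal domain; it is given through its
graph. -/
def dGammaGraph : Submodule ℂ (Fock × Fock) where
  carrier := {P | ∀ n : ℕ, ∀ᵐ k : Fin n → R3,
    (P.2 n : TensorL2 n) k = (∑ j, ‖k j‖) • (P.1 n : TensorL2 n) k}
  add_mem' := by
    intro P Q hP hQ n
    filter_upwards [hP n, hQ n, Lp.coeFn_add (P.1 n).1 (Q.1 n).1,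
      Lp.coeFn_add (P.2 n).1 (Q.2 n).1] with k h1 h2 h3 h4
    simp only [Prod.fst_add, Prod.snd_add, lp.coeFn_add, Pi.add_apply, Submodule.coe_add, h3, h4,
      h1, h2, smul_add]
  zero_mem' := by
    intro n
    filter_upwards [Lp.coeFn_zero (EuclideanSpace ℂ (Fin n → Fin 3)) 2
      (volume : Measure (Fin n → R3))] with k h1
    simp only [Prod.fst_zero, Prod.snd_zero, lp.coeFn_zero, Pi.zero_apply, Submodule.coe_zero]
    rw [h1, Pi.zero_apply, smul_zero]
  smul_mem' := by
    intro c P hP n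
    filter_upwards [hP n, Lp.coeFn_smul c (P.1 n).1, Lp.coeFn_smul c (P.2 n).1] with k h1 h3 h4
    simp only [Prod.smul_fst, Prod.smul_snd, lp.coeFn_smul, Submodule.coe_smul, h3, h4,
      Pi.smul_apply, h1]
    rw [smul_comm]

lemma dGammaGraph_functional (P : Fock × Fock) (hP : P ∈ dGammaGraph) (h0 : P.1 = 0) :
    P.2 = 0 := by
  apply lp.ext
  funext n
  apply Subtype.ext
  apply Lp.ext
  have hP' : ∀ᵐ k : Fin n → R3,
    (P.2 n : TensorL2 n) k = (∑ j, ‖k j‖) • (P.1 n : TensorL2 n) k := hP n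
  rw [h0] at hP'
  filter_upwards [hP', Lp.coeFn_zero (EuclideanSpace ℂ (Fin n → Fin 3)) 2
      (volume : Measure (Fin n → R3))] with k h1 h2
  rw [h1]
  simp only [lp.coeFn_zero, Pi.zero_apply, Submodule.coe_zero]
  rw [h2, Pi.zero_apply, smul_zero]

/-- The operator `dΓ(M)` in the Fock space. -/
def dGamma : Fock →ₗ.[ℂ] Fock := dGammaGraph.toLinearPMap

/-- The free photon energy operator `H_ph = h dΓ(M)`. -/
def photonHam (h : ℝ) : Fock →ₗ.[ℂ] Fock := (h : ℂ) • dGamma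

/-- The creation operator `a*(g)` from `n` to `n + 1` particles: `√(n+1)` times the
symmetrization (orthogonal projection on the symmetric tensors) of `g ⊗ ψ`. -/
def creation (g : Lp C3 2 (volume : Measure R3)) (n : ℕ) : symPow n →L[ℂ] symPow (n + 1) :=
  ((Real.sqrt (n + 1) : ℝ) : ℂ) •
    ((symPow (n + 1)).orthogonalProjectionOnto ∘L tens n g ∘L (symPow n).subtypeL)

/-- The annihilation operator `a(g)` from `n + 1` to `n` particles. -/
def annihilation (g : Lp C3 2 (volume : Measure R3)) (n : ℕ) : symPow (n + 1) →L[ℂ] symPow n :=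
  ContinuousLinearMap.adjoint (creation g n)

/-- The `n`-particle component of `(a(g) + a*(g)) Ψ`. -/
def fieldComp (g : Lp C3 2 (volume : Measure R3)) (Ψ : Fock) : (n : ℕ) → symPow n
  | 0 => annihilation g 0 (Ψ 1)
  | n + 1 => annihilation g (n + 1) (Ψ (n + 2)) + creation g n (Ψ n)

/-- The operator `a(g) + a*(g)` in the Fock space with its maximal domain (on which it is
selfadjoint, being the closure of its restriction to finite particle vectors), given through its
graph. -/
def fieldGraph (g : Lp C3 2 (volume : Measure R3)) : Submodule ℂ (Fock × Fock) where
  carrier := {P | ∀ n : ℕ, P.2 n = fieldComp g P.1 n}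
  add_mem' := by
    intro P Q hP hQ n
    have h1 := hP n
    have h2 := hQ n
    cases n with
    | zero =>
      simp only [fieldComp, Prod.fst_add, Prod.snd_add, lp.coeFn_add, Pi.add_apply, map_add] at *
      rw [h1, h2]
    | succ n =>
      simp only [fieldComp, Prod.fst_add, Prod.snd_add, lp.coeFn_add, Pi.add_apply, map_add] at *
      rw [h1, h2]
      abel
  zero_mem' := by
    intro n
    cases n <;> simp [fieldComp]
  smul_mem' := by
    intro c P hP n
    have h1 := hP n
    cases n with
    | zero =>
      simp only [fieldComp, Prod.smul_fst, Prod.smul_snd, lp.coeFn_smul, Pi.smul_apply,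
        map_smul] at *
      rw [h1]
    | succ n =>
      simp only [fieldComp, Prod.smul_fst, Prod.smul_snd, lp.coeFn_smul, Pi.smul_apply,
        map_smul] at *
      rw [h1, smul_add]

lemma fieldGraph_functional (g : Lp C3 2 (volume : Measure R3)) (P : Fock × Fock)
    (hP : P ∈ fieldGraph g) (h0 : P.1 = 0) : P.2 = 0 := by
  apply lp.ext
  funext n
  have h1 : P.2 n = fieldComp g P.1 n := hP n
  rw [h1, h0]
  cases n <;> simp [fieldComp]

/-- The operator `Op_h^{weyl}(F_{a,b}) = √h Φ_S(a + i b)` associated with the linear form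
`F_{a,b}(q,p) = a·q + b·p`, where `Φ_S(g) = (a(g) + a*(g)) / √2` is the Segal field. -/
def weylOp (h : ℝ) (a b : HReal) : Fock →ₗ.[ℂ] Fock :=
  ((Real.sqrt h / Real.sqrt 2 : ℝ) : ℂ) • (fieldGraph (cplx a b)).toLinearPMap

lemma norm_tensPow_le (f : Lp C3 2 (volume : Measure R3)) (n : ℕ) :
    ‖tensPow f n‖ ≤ ‖vac‖ * ‖f‖ ^ n := by
  induction n with
  | zero => simp [tensPow]
  | succ n ih =>
    calc ‖tensPow f (n + 1)‖ ≤ ‖f‖ * ‖tensPow f n‖ := norm_tens_le n f _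
      _ ≤ ‖f‖ * (‖vac‖ * ‖f‖ ^ n) := by gcongr
      _ = ‖vac‖ * ‖f‖ ^ (n + 1) := by ring

lemma tensPow_mem (q p : HReal) (n : ℕ) : tensPow (cplx q p) n ∈ symPow n :=
  Submodule.le_topologicalClosure _ (Submodule.subset_span ⟨q, p, rfl⟩)

/-- The `n`-particle component of the coherent state `Ψ_{(q,p),h}`:
`e^{-(|q|² + |p|²)/(4h)} (2h)^{-n/2} (n!)^{-1/2} (q + i p)^{⊗ n}`. -/
def coherentComp (h : ℝ) (q p : HReal) (n : ℕ) : symPow n :=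
  ((Real.exp (-(‖q‖ ^ 2 + ‖p‖ ^ 2) / (4 * h)) /
      ((2 * h) ^ ((n : ℝ) / 2) * Real.sqrt (n.factorial)) : ℝ) : ℂ) •
    ⟨tensPow (cplx q p) n, tensPow_mem q p n⟩

lemma memlp_coherentComp (h : ℝ) (hh : 0 < h) (q p : HReal) :
    Memℓp (coherentComp h q p) 2 := by
  rw [memℓp_gen_iff (by norm_num)]
  have hs : Summable (fun n : ℕ => (Real.exp (-(‖q‖ ^ 2 + ‖p‖ ^ 2) / (4 * h)) * ‖vac‖) ^ 2 *
      ((‖cplx q p‖ ^ 2 / (2 * h)) ^ n / n.factorial)) :=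
    (Real.summable_pow_div_factorial _).mul_left _
  refine Summable.of_nonneg_of_le (fun n => by positivity) (fun n => ?_) hs
  have h1 : ‖coherentComp h q p n‖ ≤ Real.exp (-(‖q‖ ^ 2 + ‖p‖ ^ 2) / (4 * h)) /
      ((2 * h) ^ ((n : ℝ) / 2) * Real.sqrt (n.factorial)) * (‖vac‖ * ‖cplx q p‖ ^ n) := by
    rw [coherentComp, norm_smul, Complex.norm_real, Real.norm_of_nonneg (by positivity)]
    gcongr
    exact norm_tensPow_le _ n
  have h2 : ((2 * h) ^ ((n : ℝ) / 2)) ^ 2 = (2 * h) ^ n := by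
    rw [← Real.rpow_natCast, ← Real.rpow_mul (by positivity), ← Real.rpow_natCast]
    congr 1
    push_cast
    ring
  have h3 : (Real.sqrt (n.factorial)) ^ 2 = n.factorial := Real.sq_sqrt (by positivity)
  calc ‖coherentComp h q p n‖ ^ (ENNReal.toReal 2) = ‖coherentComp h q p n‖ ^ 2 := by
        rw [ENNReal.toReal_ofNat]; norm_cast
    _ ≤ (Real.exp (-(‖q‖ ^ 2 + ‖p‖ ^ 2) / (4 * h)) /
      ((2 * h) ^ ((n : ℝ) / 2) * Real.sqrt (n.factorial)) * (‖vac‖ * ‖cplx q p‖ ^ n)) ^ 2 := by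
        gcongr
    _ = _ := by
        rw [mul_pow, div_pow, mul_pow, mul_pow, mul_pow, h2, h3, div_pow, ← pow_mul, ← pow_mul,
          mul_comm n 2]
        field_simp

/-- The coherent state `Ψ_{(q,p),h}`. -/
def coherent (h : ℝ) (hh : 0 < h) (q p : HReal) : Fock :=
  ⟨coherentComp h q p, memlp_coherentComp h hh q p⟩

/-! ### The magnetic field -/

/-- The function `k ↦ χ(|k|) |k|^{1/2} (2π)^{-3/2} s(k·x) (k ∧ e_m)/|k|`, with `s` equal to `sin`
or `cos`. -/
def fieldFun (χ : 𝓢(ℝ, ℝ)) (s : ℝ → ℝ) (x : R3) (m : Fin 3) (k : R3) : R3 :=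
  (χ ‖k‖ * ‖k‖ ^ (1 / 2 : ℝ) / (2 * Real.pi) ^ (3 / 2 : ℝ) * s (inner ℝ k x)) •
    (‖k‖⁻¹ • WithLp.toLp 2 (crossProduct (WithLp.ofLp k) (Pi.single m 1)))

lemma norm_cross_le (k : R3) (m : Fin 3) :
    ‖(WithLp.toLp 2 (crossProduct (WithLp.ofLp k) (Pi.single m 1)) : R3)‖ ≤ ‖k‖ := by
  apply (pow_le_pow_iff_left₀ (norm_nonneg _) (norm_nonneg _) two_ne_zero).1
  rw [EuclideanSpace.norm_sq_eq, EuclideanSpace.norm_sq_eq, Fin.sum_univ_three,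
    Fin.sum_univ_three]
  fin_cases m <;> simp [crossProduct] <;> nlinarith [sq_nonneg (k 0), sq_nonneg (k 1), sq_nonneg (k 2)]

lemma norm_fieldFun_le (χ : 𝓢(ℝ, ℝ)) (s : ℝ → ℝ) (hs : ∀ t, |s t| ≤ 1) (x : R3) (m : Fin 3)
    (k : R3) : ‖fieldFun χ s x m k‖ ≤ |χ ‖k‖| * ‖k‖ ^ (1 / 2 : ℝ) := by
  have h1 : ‖(‖k‖⁻¹ • WithLp.toLp 2 (crossProduct (WithLp.ofLp k) (Pi.single m 1)) : R3)‖ ≤ 1 := by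
    rw [norm_smul, norm_inv, norm_norm]
    calc ‖k‖⁻¹ * _ ≤ ‖k‖⁻¹ * ‖k‖ := by gcongr; exact norm_cross_le k m
      _ ≤ 1 := inv_mul_le_one
  have h2 : (1 : ℝ) ≤ (2 * Real.pi) ^ (3 / 2 : ℝ) :=
    Real.one_le_rpow (by linarith [Real.pi_gt_three]) (by norm_num)
  rw [fieldFun, norm_smul, Real.norm_eq_abs, abs_mul, abs_div, abs_mul,
    abs_of_nonneg (Real.rpow_nonneg (norm_nonneg k) _), abs_of_nonneg (zero_le_one.trans h2)]
  have h3 : |χ ‖k‖| * ‖k‖ ^ (1 / 2 : ℝ) / (2 * Real.pi) ^ (3 / 2 : ℝ) ≤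
      |χ ‖k‖| * ‖k‖ ^ (1 / 2 : ℝ) := div_le_self (by positivity) h2
  calc _ ≤ |χ ‖k‖| * ‖k‖ ^ (1 / 2 : ℝ) * 1 * 1 := by
        gcongr
        exact hs _
    _ = _ := by ring

lemma memLp_fieldFun (χ : 𝓢(ℝ, ℝ)) (s : ℝ → ℝ) (hc : Continuous s) (hs : ∀ t, |s t| ≤ 1) (x : R3)
    (m : Fin 3) : MemLp (fieldFun χ s x m) 2 (volume : Measure R3) := by
  obtain ⟨C, hC⟩ : ∃ C : ℝ, ∀ r : ℝ, 0 ≤ r → |χ r| * r ^ (1 / 2 : ℝ) ≤ C * (1 + r) ^ (-2 : ℝ) := by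
    refine ⟨2 ^ 3 * (Finset.Iic (3, 0)).sup (fun m => SchwartzMap.seminorm ℝ m.1 m.2) χ,
      fun r hr => ?_⟩
    have h1 := SchwartzMap.one_add_le_sup_seminorm_apply (𝕜 := ℝ) (m := (3, 0)) (k := 3) (n := 0)
      le_rfl le_rfl χ r
    rw [norm_iteratedFDeriv_zero, Real.norm_of_nonneg hr, Real.norm_eq_abs] at h1
    have h2 : r ^ (1 / 2 : ℝ) ≤ 1 + r := by
      rw [← Real.sqrt_eq_rpow]
      apply Real.sqrt_le_iff.2
      constructor
      · linarith
      · nlinarith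
    have h3 : (1 + r) ^ (-2 : ℝ) = 1 / (1 + r) ^ 2 := by
      rw [Real.rpow_neg (by linarith), one_div]
      norm_cast
    rw [h3, mul_one_div, le_div_iff₀ (by positivity)]
    calc |χ r| * r ^ (1 / 2 : ℝ) * (1 + r) ^ 2 ≤ |χ r| * (1 + r) * (1 + r) ^ 2 := by gcongr
      _ = (1 + r) ^ 3 * |χ r| := by ring
      _ ≤ _ := h1
  have hm : Measurable (fieldFun χ s x m) := by
    have h0 : Continuous (fun k : R3 =>
        (WithLp.toLp 2 (crossProduct (WithLp.ofLp k) (Pi.single m 1)) : R3)) := by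
      have h00 : Continuous (fun v : Fin 3 → ℝ => crossProduct v (Pi.single m 1)) :=
        (LinearMap.continuous_of_finiteDimensional
          ((crossProduct (R := ℝ)).flip (Pi.single m 1)))
      fun_prop
    have h1 : Measurable (fun k : R3 => χ ‖k‖) := (χ.continuous.comp continuous_norm).measurable
    have h2 : Measurable (fun k : R3 => s (inner ℝ k x)) := by
      apply Continuous.measurable
      fun_prop
    unfold fieldFun
    exact (((h1.mul (measurable_norm.pow_const _)).div_const _).mul h2).smul
      (measurable_norm.inv.smul h0.measurable)
  have hb : MemLp (fun k : R3 => C * (1 + ‖k‖) ^ (-2 : ℝ)) 2 volume := by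
    have hcont : Continuous (fun k : R3 => (1 + ‖k‖) ^ (-2 : ℝ)) :=
      (by fun_prop : Continuous fun k : R3 => 1 + ‖k‖).rpow_const
        (fun k => Or.inl (by positivity))
    apply MemLp.const_mul
    rw [memLp_two_iff_integrable_sq hcont.aestronglyMeasurable]
    have h4 := integrable_one_add_norm (μ := (volume : Measure R3)) (r := 4) (by simp; norm_num)
    refine h4.congr (Filter.Eventually.of_forall fun k => ?_)
    simp only
    rw [← Real.rpow_natCast, ← Real.rpow_mul (by positivity)]
    norm_num
  refine hb.mono' hm.aestronglyMeasurable (Filter.Eventually.of_forall fun k => ?_)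
  exact (norm_fieldFun_le χ s hs x m k).trans (hC _ (norm_nonneg k))

lemma fieldFun_mem (χ : 𝓢(ℝ, ℝ)) (s : ℝ → ℝ) (hc : Continuous s) (hs : ∀ t, |s t| ≤ 1) (x : R3)
    (m : Fin 3) : (memLp_fieldFun χ s hc hs x m).toLp _ ∈ HReal := by
  change ∀ᵐ k : R3, _
  filter_upwards [(memLp_fieldFun χ s hc hs x m).coeFn_toLp] with k hk
  rw [hk, fieldFun, inner_smul_right, inner_smul_right]
  have : inner ℝ k (WithLp.toLp 2 (crossProduct (WithLp.ofLp k) (Pi.single m 1)) : R3) = 0 := by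
    rw [EuclideanSpace.inner_eq_star_dotProduct, dotProduct_comm]
    simp
  rw [this, mul_zero, mul_zero]

/-- The element `a_m(x)` of `H`. -/
def fieldA (χ : 𝓢(ℝ, ℝ)) (x : R3) (m : Fin 3) : HReal :=
  ⟨_, fieldFun_mem χ Real.sin Real.continuous_sin Real.abs_sin_le_one x m⟩

/-- The element `b_m(x)` of `H`. -/
def fieldB (χ : 𝓢(ℝ, ℝ)) (x : R3) (m : Fin 3) : HReal :=
  ⟨_, fieldFun_mem χ Real.cos Real.continuous_cos Real.abs_cos_le_one x m⟩

/-- The symbol `B_m(x, q, p) = a_m(x)·q + b_m(x)·p`. -/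
def magSymbol (χ : 𝓢(ℝ, ℝ)) (x : R3) (m : Fin 3) (q p : HReal) : ℝ :=
  inner ℝ (fieldA χ x m) q + inner ℝ (fieldB χ x m) p

/-- The operator `B_m(x)`, in the Fock space. -/
def magOp (h : ℝ) (χ : 𝓢(ℝ, ℝ)) (x : R3) (m : Fin 3) : Fock →ₗ.[ℂ] Fock :=
  weylOp h (fieldA χ x m) (fieldB χ x m)

/-- The operator `β_m + B_m(x)`. -/
def totalMagOp (h : ℝ) (χ : 𝓢(ℝ, ℝ)) (β : R3) (x : R3) (m : Fin 3) : Fock →ₗ.[ℂ] Fock :=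
  ((β m : ℂ) • (LinearMap.id : Fock →ₗ[ℂ] Fock)) +ᵥ magOp h χ x m

/-! ### Spins -/

/-- The spin space `(ℂ²)^{⊗ N}`, given by coordinates in the canonical basis. -/
abbrev SpinSpace (N : ℕ) : Type := EuclideanSpace ℂ (Fin N → Fin 2)

/-- The square matrices acting in the spin space. -/
abbrev SpinMat (N : ℕ) : Type := Matrix (Fin N → Fin 2) (Fin N → Fin 2) ℂ

/-- The Pauli matrices. -/
def pauli : Fin 3 → Matrix (Fin 2) (Fin 2) ℂ
  | 0 => !![0, 1; 1, 0]
  | 1 => !![0, -Complex.I; Complex.I, 0]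
  | 2 => !![1, 0; 0, -1]

/-- The tensor product `A₁ ⊗ ⋯ ⊗ A_N`. -/
def kron {N : ℕ} (A : Fin N → Matrix (Fin 2) (Fin 2) ℂ) : SpinMat N :=
  Matrix.of fun s t => ∏ μ, A μ (s μ) (t μ)

/-- `σ_m^{[l]} = I ⊗ ⋯ ⊗ σ_m ⊗ ⋯ ⊗ I`, with `σ_m` at the position `l`. -/
def sigma {N : ℕ} (l : Fin N) (m : Fin 3) : SpinMat N :=
  kron (Function.update (fun _ => 1) l (pauli m))

/-- The tensor product `v₁ ⊗ ⋯ ⊗ v_N`. -/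
def tprodVec {N : ℕ} (v : Fin N → EuclideanSpace ℂ (Fin 2)) : SpinSpace N :=
  WithLp.toLp 2 fun s => ∏ μ, v μ (s μ)

/-- The vector `a_E`: the tensor product with factors `b₁` at the positions in `E` and `b₀` at the
other positions. -/
def spinState {N : ℕ} (b₀ b₁ : EuclideanSpace ℂ (Fin 2)) (E : Finset (Fin N)) : SpinSpace N :=
  tprodVec fun j => if j ∈ E then b₁ else b₀

/-- The Lie algebra of `SU(2^N)`: traceless antihermitian matrices. -/
def suLie (N : ℕ) : Submodule ℝ (SpinMat N) where
  carrier := {Y | Yᴴ = -Y ∧ Y.trace = 0}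
  add_mem' := by
    rintro X Y ⟨h1, h2⟩ ⟨h3, h4⟩
    exact ⟨by rw [Matrix.conjTranspose_add, h1, h3, neg_add, add_comm], by
      rw [Matrix.trace_add, h2, h4, add_zero]⟩
  zero_mem' := ⟨by simp, by simp⟩
  smul_mem' := by
    rintro c Y ⟨h1, h2⟩
    exact ⟨by rw [Matrix.conjTranspose_smul, h1, star_trivial, smul_neg], by
      rw [Matrix.trace_smul, h2, smul_zero]⟩

/-- The bracket `[X, Y] = X Y - Y X`. -/
def suBracket {N : ℕ} (X Y : suLie N) : suLie N :=
  ⟨(X : SpinMat N) * Y - Y * X, by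
    obtain ⟨h1, _⟩ := X.2
    obtain ⟨h3, _⟩ := Y.2
    refine ⟨?_, ?_⟩
    · rw [Matrix.conjTranspose_sub, Matrix.conjTranspose_mul, Matrix.conjTranspose_mul, h1, h3]
      noncomm_ring
    · rw [Matrix.trace_sub, Matrix.trace_mul_comm, sub_self]⟩

lemma pauli_conjTranspose (m : Fin 3) : (pauli m)ᴴ = pauli m := by
  fin_cases m <;> ext i j <;> fin_cases i <;> fin_cases j <;> simp [pauli]

lemma pauli_trace (m : Fin 3) : (pauli m).trace = 0 := by
  fin_cases m <;> simp [pauli, Matrix.trace_fin_two]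

lemma kron_trace {N : ℕ} (A : Fin N → Matrix (Fin 2) (Fin 2) ℂ) :
    (kron A).trace = ∏ μ, (A μ).trace := by
  simp only [Matrix.trace, Matrix.diag, kron, Matrix.of_apply]
  rw [Finset.prod_univ_sum, Fintype.piFinset_univ]

lemma kron_conjTranspose {N : ℕ} (A : Fin N → Matrix (Fin 2) (Fin 2) ℂ) :
    (kron A)ᴴ = kron (fun μ => (A μ)ᴴ) := by
  ext s t
  simp [kron, Matrix.conjTranspose_apply]

lemma sigma_conjTranspose {N : ℕ} (l : Fin N) (m : Fin 3) : (sigma l m)ᴴ = sigma l m := by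
  rw [sigma, kron_conjTranspose]
  congr 1
  funext μ
  by_cases hμ : μ = l
  · subst hμ
    simp [pauli_conjTranspose]
  · simp [Function.update_of_ne hμ]

lemma sigma_trace {N : ℕ} (l : Fin N) (m : Fin 3) : (sigma l m).trace = 0 := by
  rw [sigma, kron_trace]
  apply Finset.prod_eq_zero (Finset.mem_univ l)
  rw [Function.update_self, pauli_trace]

/-- The element `i σ_m^{[l]}` of the Lie algebra. -/
def iSigma {N : ℕ} (l : Fin N) (m : Fin 3) : suLie N :=
  ⟨Complex.I • sigma l m, by
    refine ⟨?_, ?_⟩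
    · rw [Matrix.conjTranspose_smul, sigma_conjTranspose]
      simp
    · rw [Matrix.trace_smul, sigma_trace, smul_zero]⟩

/-- The expectation `⟨A a, a⟩`. (The inner product of Mathlib is linear in its second
argument.) -/
def expect {N : ℕ} (A : SpinMat N) (a : SpinSpace N) : ℂ :=
  inner ℂ a (Matrix.toEuclideanLin A a)

/-- The linear form `π_a` on the Lie algebra: `⟨π_a, Y⟩ = i⁻¹ ⟨Y a, a⟩`, a real number since `Y` is
antihermitian. -/
def piForm {N : ℕ} (a : SpinSpace N) : Module.Dual ℝ (suLie N) where
  toFun Y := (Complex.I⁻¹ * expect (Y : SpinMat N) a).re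
  map_add' := by
    intro X Y
    simp [expect, mul_add]
  map_smul' := by
    intro c Y
    have : Matrix.toEuclideanLin ((c • Y : suLie N) : SpinMat N) a =
        (c : ℂ) • Matrix.toEuclideanLin (Y : SpinMat N) a := by
      rw [← LinearMap.smul_apply, ← map_smul]
      congr 2
    simp only [expect, this, inner_smul_right, RingHom.id_apply, smul_eq_mul]
    rw [mul_left_comm, Complex.re_ofReal_mul]

/-! ### The classical Hamiltonian system -/

/-- The Hamiltonian function `H_ph(q,p) = ½ ∫ |k| (|q(k)|² + |p(k)|²) dk` of the free field. -/
def photonEnergy (q p : HReal) : ℝ :=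
  (1 / 2) * ∫ k : R3, ‖k‖ * (‖(q : Lp R3 2 (volume : Measure R3)) k‖ ^ 2 +
    ‖(p : Lp R3 2 (volume : Measure R3)) k‖ ^ 2)

/-- The Hamiltonian function `H(q,p,ω)`. -/
def classicalHam {N : ℕ} (h : ℝ) (χ : 𝓢(ℝ, ℝ)) (x : Fin N → R3) (β : R3) (q p : HReal)
    (ω : Module.Dual ℝ (suLie N)) : ℝ :=
  photonEnergy q p +
    h * ∑ l, ∑ m, (β m + magSymbol χ (x l) m q p) * ω (iSigma l m)

/-- `t ↦ (q(t), p(t), ω(t))` is a (strong) solution to the Hamiltonian system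
`q' = M p + h ∑ b_m(x_l) ⟨ω, iσ_m^{[l]}⟩`, `p' = - M q - h ∑ a_m(x_l) ⟨ω, iσ_m^{[l]}⟩`,
`⟨ω, Y⟩' = ∑ (β_m + B_m(x_l, q, p)) ⟨ω, [iσ_m^{[l]}, Y]⟩` for all `Y` in the Lie algebra. -/
def IsSolution {N : ℕ} (h : ℝ) (χ : 𝓢(ℝ, ℝ)) (x : Fin N → R3) (β : R3) (q p : ℝ → HReal)
    (ω : ℝ → Module.Dual ℝ (suLie N)) : Prop :=
  ∀ t : ℝ, ∃ (hq : q t ∈ freqMul.domain) (hp : p t ∈ freqMul.domain),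
    HasDerivAt q (freqMul ⟨p t, hp⟩ + h • ∑ l, ∑ m, ω t (iSigma l m) • fieldB χ (x l) m) t ∧
    HasDerivAt p (-freqMul ⟨q t, hq⟩ - h • ∑ l, ∑ m, ω t (iSigma l m) • fieldA χ (x l) m) t ∧
    ∀ Y : suLie N, HasDerivAt (fun s => ω s Y)
      (∑ l, ∑ m, (β m + magSymbol χ (x l) m (q t) (p t)) * ω t (suBracket (iSigma l m) Y)) t

/-- `(q, p, ω)` is a stationary (fixed) point of the Hamiltonian system: the constant curve is a
solution. -/
def IsStationaryPoint {N : ℕ} (h : ℝ) (χ : 𝓢(ℝ, ℝ)) (x : Fin N → R3) (β : R3) (q p : HReal)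
    (ω : Module.Dual ℝ (suLie N)) : Prop :=
  IsSolution h χ x β (fun _ => q) (fun _ => p) (fun _ => ω)

/-! ### The quantum Hamiltonian -/

/-- The Hilbert space `H_ph ⊗ H_sp`; as `H_sp` has finite dimension, no completion is needed. -/
abbrev TotalSpace (N : ℕ) : Type := Fock ⊗[ℂ] SpinSpace N

/-- The operator `A ⊗ S` in `H_ph ⊗ H_sp`, with domain `D(A) ⊗ H_sp`, given through its graph. -/
def tensorOpGraph {N : ℕ} (A : Fock →ₗ.[ℂ] Fock) (S : SpinMat N) :
    Submodule ℂ (TotalSpace N × TotalSpace N) :=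
  LinearMap.range ((TensorProduct.map A.domain.subtype LinearMap.id).prod
    (TensorProduct.map A.toFun (Matrix.toEuclideanLin S)))

lemma tensorOpGraph_functional {N : ℕ} (A : Fock →ₗ.[ℂ] Fock) (S : SpinMat N)
    (P : TotalSpace N × TotalSpace N) (hP : P ∈ tensorOpGraph A S) (h0 : P.1 = 0) : P.2 = 0 := by
  obtain ⟨u, rfl⟩ := hP
  have hinj : Function.Injective (LinearMap.rTensor (SpinSpace N) A.domain.subtype) :=
    Module.Flat.rTensor_preserves_injective_linearMap _ A.domain.injective_subtype
  have hu : u = 0 := hinj (by rw [map_zero]; exact h0)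
  simp [hu]

/-- The operator `A ⊗ S` in `H_ph ⊗ H_sp`. -/
def tensorOp {N : ℕ} (A : Fock →ₗ.[ℂ] Fock) (S : SpinMat N) :
    TotalSpace N →ₗ.[ℂ] TotalSpace N := (tensorOpGraph A S).toLinearPMap

/-- The Hamiltonian operator
`H(h) = H_ph ⊗ I + h ∑_l ∑_m (β_m + B_m(x_l)) ⊗ σ_m^{[l]}`, a sum of unbounded operators, defined
on the intersection of the domains. -/
def quantumHam {N : ℕ} (h : ℝ) (χ : 𝓢(ℝ, ℝ)) (x : Fin N → R3) (β : R3) :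
    TotalSpace N →ₗ.[ℂ] TotalSpace N :=
  tensorOp (photonHam h) 1 + (h : ℂ) • ∑ l, ∑ m, tensorOp (totalMagOp h χ β (x l) m) (sigma l m)

/-- The reduced operator `H_ph + h ∑_l ∑_m ⟨σ_m^{[l]} a, a⟩ (β_m + B_m(x_l))` in the Fock
space. -/
def reducedHam {N : ℕ} (h : ℝ) (χ : 𝓢(ℝ, ℝ)) (x : Fin N → R3) (β : R3) (a : SpinSpace N) :
    Fock →ₗ.[ℂ] Fock :=
  photonHam h + (h : ℂ) • ∑ l, ∑ m, expect (sigma l m) a • totalMagOp h χ β (x l) m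

end SpinPhoton

end

noncomputable section

namespace SpinPhoton

/-! ### Tensor products of `L²` functions -/

/-! Write `f = q + ip`, `g_{l,m} = a_m(x_l) + i b_m(x_l)`, `Ψ` for the coherent state and `ω_{l,m}`
for `⟨ω, iσ_m^{[l]}⟩`. Everything rests on two identities: `Ψ` is an eigenvector of every
annihilation operator, `a(g)Ψ = (2h)^{-1/2}⟨g, f⟩Ψ` with the inner product antilinear in `g`
(`annihilation_coherent`), and second quantization acts on it as one creation operator, `dΓ(M)Ψ =
(2h)^{-1/2} a*(Mf)Ψ` (`coherent_mem_dGammaGraph`).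

Stationarity says `Mf = -h ∑ ω_{l,m} g_{l,m}`, hence `H_ph Ψ` is exactly minus the creation half of
the averaged interaction. In `reducedHam_coherent` these cancel and a scalar is left, `h ∑
ω_{l,m}(β_m + ⟨g_{l,m}, f⟩/2)`. Pairing the stationarity relation with `f` gives `h ∑
ω_{l,m}⟨g_{l,m}, f⟩ = -2 H_ph(q,p)`, which turns this scalar into the classical energy.

For the full Hamiltonian, the constant field acts on the product state `a_E` by `(2|E| - N)|β|h`.
What is left consists of field terms, each with prefactor `h √(h/2)` once `‖f‖ / √(2h)` is bounded.
That bound holds because the form factors lie in the range of `M`: `|k|⁻¹` times them is square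
integrable in dimension three. Inverting `M` gives `‖q‖, ‖p‖ = O(h)`
(`exists_norm_le_of_isStationaryPoint`), and `norm_spinRemainder_le` collects the estimates. -/

lemma coeFn_tens (n : ℕ) (g : Lp C3 2 (volume : Measure R3)) (ψ : TensorL2 n) :
    tens n g ψ =ᵐ[volume] tensFun n g ψ :=
  (memLp_tensFun n g ψ).coeFn_toLp

lemma tens_add_left (n : ℕ) (g g' : Lp C3 2 (volume : Measure R3)) (ψ : TensorL2 n) :
    tens n (g + g') ψ = tens n g ψ + tens n g' ψ := by
  apply Lp.ext
  filter_upwards [coeFn_tens n (g + g') ψ, coeFn_tens n g ψ, coeFn_tens n g' ψ,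
    Lp.coeFn_add (tens n g ψ) (tens n g' ψ), (qmp_head n).ae (Lp.coeFn_add g g')]
    with k h1 h2 h3 h4 h5
  rw [h4, Pi.add_apply, h1, h2, h3]
  ext c
  simp only [tensFun, tensVec, h5]
  simp [add_mul]

lemma tens_smul_left (n : ℕ) (z : ℂ) (g : Lp C3 2 (volume : Measure R3)) (ψ : TensorL2 n) :
    tens n (z • g) ψ = z • tens n g ψ := by
  apply Lp.ext
  filter_upwards [coeFn_tens n (z • g) ψ, coeFn_tens n g ψ,
    Lp.coeFn_smul z (tens n g ψ), (qmp_head n).ae (Lp.coeFn_smul z g)] with k h1 h2 h4 h5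
  rw [h4, Pi.smul_apply, h1, h2]
  ext c
  simp only [tensFun, tensVec, h5]
  simp [mul_assoc]

/-- The tensor product as a continuous bilinear map. -/
def tensL (n : ℕ) : Lp C3 2 (volume : Measure R3) →L[ℂ] TensorL2 n →L[ℂ] TensorL2 (n + 1) :=
  LinearMap.mkContinuous
    { toFun := tens n
      map_add' := fun g g' => by ext1 ψ; exact tens_add_left n g g' ψ
      map_smul' := fun z g => by ext1 ψ; exact tens_smul_left n z g ψ } 1
    (fun g => by
      rw [one_mul]
      exact ContinuousLinearMap.opNorm_le_bound _ (norm_nonneg _) (norm_tens_le n g))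

lemma inner_tensVec (n : ℕ) (v v' : C3) (w w' : EuclideanSpace ℂ (Fin n → Fin 3)) :
    inner ℂ (tensVec n v w) (tensVec n v' w') = inner ℂ v v' * inner ℂ w w' := by
  rw [PiLp.inner_apply, PiLp.inner_apply, PiLp.inner_apply, Finset.sum_mul_sum,
    ← Finset.sum_product']
  symm
  apply Fintype.sum_equiv (Fin.consEquiv (fun _ : Fin (n + 1) => Fin 3))
  rintro ⟨i, c⟩
  have hc : Fin.tail ((Fin.consEquiv fun _ : Fin (n + 1) => Fin 3) (i, c)) = c := rfl
  simp only [tensVec, hc, Fin.consEquiv_apply, Fin.cons_zero, RCLike.inner_apply, map_mul]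
  ring

lemma inner_tens (n : ℕ) (g g' : Lp C3 2 (volume : Measure R3)) (ψ ψ' : TensorL2 n) :
    inner ℂ (tens n g ψ) (tens n g' ψ') = inner ℂ g g' * inner ℂ ψ ψ' := by
  rw [L2.inner_def, L2.inner_def, L2.inner_def]
  have h := (volume_preserving_piFinSuccAbove (fun _ : Fin (n + 1) => R3) 0)
  have h1 : (fun k => inner ℂ (tens n g ψ k) (tens n g' ψ' k)) =ᵐ[volume] fun k =>
      (fun P : R3 × (Fin n → R3) => inner ℂ (g P.1) (g' P.1) * inner ℂ (ψ P.2) (ψ' P.2))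
        (MeasurableEquiv.piFinSuccAbove (fun _ : Fin (n + 1) => R3) 0 k) := by
    filter_upwards [coeFn_tens n g ψ, coeFn_tens n g' ψ'] with k h2 h3
    rw [h2, h3, tensFun, tensFun, inner_tensVec]
    rfl
  rw [integral_congr_ae h1]
  refine (h.integral_comp (MeasurableEquiv.measurableEmbedding _)
    (fun P : R3 × (Fin n → R3) => inner ℂ (g P.1) (g' P.1) * inner ℂ (ψ P.2) (ψ' P.2))).trans ?_
  exact integral_prod_mul (fun k : R3 => inner ℂ (g k) (g' k))
    (fun k : Fin n → R3 => inner ℂ (ψ k) (ψ' k))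

/-! ### Derivatives of tensor powers -/

/-- The derivative of `f ↦ f ⊗ ⋯ ⊗ f` in the direction `u`, that is
`∑ⱼ f ⊗ ⋯ ⊗ u ⊗ ⋯ ⊗ f`. -/
def tensPowDeriv (f u : Lp C3 2 (volume : Measure R3)) : (n : ℕ) → TensorL2 n
  | 0 => 0
  | n + 1 => tens n u (tensPow f n) + tens n f (tensPowDeriv f u n)

/-- Differentiability serves to realize `tensPowDeriv` as a limit of differences of tensor powers.
-/
lemma hasDerivAt_tensPow (f u : Lp C3 2 (volume : Measure R3)) (n : ℕ) :
    HasDerivAt (fun z : ℂ => tensPow (f + z • u) n) (tensPowDeriv f u n) 0 := by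
  induction n with
  | zero => exact hasDerivAt_const _ _
  | succ n ih =>
    have h1 : HasDerivAt (fun z : ℂ => f + z • u) u 0 := by
      simpa using ((hasDerivAt_id (0 : ℂ)).smul_const u).const_add f
    have h2 : HasDerivAt (fun z : ℂ => tensL n (f + z • u)) (tensL n u) 0 :=
      (tensL n).hasFDerivAt.comp_hasDerivAt (0 : ℂ) h1
    have h3 := h2.clm_apply ih
    simp only [zero_smul, add_zero] at h3
    exact h3

/-- Against a pure power each of the `n + 1` slots for `u` gives the same value `⟨g, u⟩⟨g, f⟩ⁿ`, so
the sum is `n + 1` times its first term. -/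
lemma inner_tensPow_tensPowDeriv (g f u : Lp C3 2 (volume : Measure R3)) (n : ℕ) :
    inner ℂ (tensPow g (n + 1)) (tensPowDeriv f u (n + 1)) =
      ((n : ℂ) + 1) * inner ℂ (tensPow g (n + 1)) (tens n u (tensPow f n)) := by
  induction n with
  | zero => simp [tensPowDeriv]
  | succ n ih =>
    have h1 : tensPowDeriv f u (n + 2) =
      tens (n + 1) u (tensPow f (n + 1)) + tens (n + 1) f (tensPowDeriv f u (n + 1)) := rfl
    have h2 (w : Lp C3 2 (volume : Measure R3)) (ψ : TensorL2 (n + 1)) :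
        inner ℂ (tensPow g (n + 2)) (tens (n + 1) w ψ) =
          inner ℂ g w * inner ℂ (tensPow g (n + 1)) ψ := inner_tens _ _ _ _ _
    have h3 (w : Lp C3 2 (volume : Measure R3)) :
        inner ℂ (tensPow g (n + 1)) (tens n w (tensPow f n)) =
          inner ℂ g w * inner ℂ (tensPow g n) (tensPow f n) := inner_tens _ _ _ _ _
    have h4 : inner ℂ (tensPow g (n + 1)) (tensPow f (n + 1)) =
          inner ℂ g f * inner ℂ (tensPow g n) (tensPow f n) := h3 f
    rw [h1, inner_add_right, h2, h2, ih, h3, h4]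
    push_cast
    ring

/-! ### Linearity of the complexification and symmetry of the derivatives -/

lemma cplx_add (q p q' p' : HReal) : cplx (q + q') (p + p') = cplx q p + cplx q' p' := by
  simp only [cplx, Submodule.coe_add, map_add, smul_add]
  abel

lemma real_smul_eq_complex_smul (t : ℝ) (f : Lp C3 2 (volume : Measure R3)) :
    t • f = (t : ℂ) • f := by
  apply Lp.ext
  filter_upwards [Lp.coeFn_smul t f, Lp.coeFn_smul (t : ℂ) f] with k h1 h2
  rw [h1, h2]
  ext i
  simp

lemma cplx_real_smul (t : ℝ) (q p : HReal) : cplx (t • q) (t • p) = (t : ℂ) • cplx q p := by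
  simp only [cplx, Submodule.coe_smul, map_smul, smul_add]
  rw [smul_comm (t : ℂ) Complex.I, real_smul_eq_complex_smul, real_smul_eq_complex_smul]

/-- Difference quotients of tensor powers lie in `symPow n`, which is closed, so their limit does
too. -/
lemma tensPowDeriv_mem (q p q' p' : HReal) (n : ℕ) :
    tensPowDeriv (cplx q p) (cplx q' p') n ∈ symPow n := by
  have h1 := hasDerivAt_iff_tendsto_slope.1 (hasDerivAt_tensPow (cplx q p) (cplx q' p') n)
  -- Real increments suffice, and they keep `f + z • u` of the form `cplx` by `cplx_real_smul`.
  have h2 : Filter.Tendsto (fun j : ℕ => (((1 / ((j : ℝ) + 1) : ℝ)) : ℂ)) Filter.atTop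
      (nhdsWithin 0 {0}ᶜ) := by
    rw [tendsto_nhdsWithin_iff]
    constructor
    · have := (Complex.continuous_ofReal.tendsto 0).comp
        (tendsto_one_div_add_atTop_nhds_zero_nat (𝕜 := ℝ))
      simpa only [Complex.ofReal_zero, Function.comp_def] using this
    · refine Filter.Eventually.of_forall fun j => ?_
      simp only [Set.mem_compl_iff, Set.mem_singleton_iff, Complex.ofReal_eq_zero]
      positivity
  refine (Submodule.isClosed_topologicalClosure _).mem_of_tendsto (h1.comp h2)
    (Filter.Eventually.of_forall fun j => ?_)
  simp only [Function.comp_apply, slope, vsub_eq_sub, zero_smul, add_zero]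
  rw [← cplx_real_smul, ← cplx_add]
  exact Submodule.smul_mem _ _ (Submodule.sub_mem _ (tensPow_mem _ _ n) (tensPow_mem _ _ n))

/-- If `u(k) = |k| f(k)`, then multiplication by `|k₁| + ⋯ + |kₙ|` sends `f ⊗ ⋯ ⊗ f` to
`∑ⱼ f ⊗ ⋯ ⊗ u ⊗ ⋯ ⊗ f`. -/
lemma tensPowDeriv_ae_eq {f u : Lp C3 2 (volume : Measure R3)}
    (hu : ∀ᵐ k : R3, u k = (‖k‖ : ℂ) • f k) (n : ℕ) :
    ∀ᵐ k : Fin n → R3, tensPowDeriv f u n k = (∑ j, ‖k j‖) • tensPow f n k := by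
  induction n with
  | zero =>
    refine Filter.Eventually.of_forall fun k => ?_
    simp [tensPowDeriv]
  | succ n ih =>
    filter_upwards [coeFn_tens n u (tensPow f n), coeFn_tens n f (tensPow f n),
      coeFn_tens n f (tensPowDeriv f u n), (qmp_head n).ae hu, (qmp_tail n).ae ih,
      Lp.coeFn_add (tens n u (tensPow f n)) (tens n f (tensPowDeriv f u n))]
      with k h1 h2 h3 h4 h5 h6
    rw [tensPowDeriv, h6, Pi.add_apply, h1, h3, tensPow, h2]
    simp only [tensFun, h4, h5]
    ext c
    simp only [tensVec, PiLp.add_apply, PiLp.smul_apply, smul_eq_mul, Complex.real_smul,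
      Fin.sum_univ_succ, Fin.tail]
    push_cast
    ring

/-! ### Creation and annihilation operators on tensor powers -/

/-- The orthogonal complement of `ψ` is a closed subspace, so containing the generators it contains
`symPow n`. -/
lemma inner_eq_zero_of_forall_tensPow {n : ℕ} {ψ : TensorL2 n}
    (h : ∀ q p : HReal, inner ℂ (tensPow (cplx q p) n) ψ = 0) {φ : TensorL2 n}
    (hφ : φ ∈ symPow n) : inner ℂ φ ψ = 0 := by
  have h1 : symPow n ≤ (ℂ ∙ ψ)ᗮ := by
    refine Submodule.topologicalClosure_minimal _ ?_ (Submodule.isClosed_orthogonal _)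
    rw [Submodule.span_le]
    rintro _ ⟨q, p, rfl⟩
    exact Submodule.mem_orthogonal_singleton_iff_inner_left.2 (h q p)
  exact Submodule.mem_orthogonal_singleton_iff_inner_left.1 (h1 hφ)

lemma creation_apply (g : Lp C3 2 (volume : Measure R3)) (n : ℕ) (ψ : symPow n) :
    creation g n ψ = ((Real.sqrt (n + 1) : ℝ) : ℂ) •
      (symPow (n + 1)).orthogonalProjectionOnto (tens n g ψ) := rfl

/-- The symmetrization of `u ⊗ f^{⊗n}` is the average over the slots of `u`. As `symPow` is a closed
span, the projection is identified by membership of the average and orthogonality of the difference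
to all tensor powers. -/
lemma creation_tensPow (q p q' p' : HReal) (n : ℕ) :
    (creation (cplx q' p') n ⟨tensPow (cplx q p) n, tensPow_mem q p n⟩ : TensorL2 (n + 1)) =
      ((Real.sqrt (n + 1) / (n + 1) : ℝ) : ℂ) •
        tensPowDeriv (cplx q p) (cplx q' p') (n + 1) := by
  set u := cplx q' p'
  set f := cplx q p
  have h0 : ((n : ℂ) + 1) ≠ 0 := by exact_mod_cast Nat.succ_ne_zero n
  have h1 : ((symPow (n + 1)).orthogonalProjectionOnto (tens n u (tensPow f n)) :
      TensorL2 (n + 1)) = ((n : ℂ) + 1)⁻¹ • tensPowDeriv f u (n + 1) := by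
    refine Submodule.eq_starProjection_of_mem_of_inner_eq_zero
      (Submodule.smul_mem _ _ (tensPowDeriv_mem q p q' p' (n + 1))) ?_
    intro w hw
    rw [← inner_conj_symm, inner_eq_zero_of_forall_tensPow _ hw, map_zero]
    intro q₁ p₁
    rw [inner_sub_right, inner_smul_right, inner_tensPow_tensPowDeriv]
    field_simp
    simp
  rw [creation_apply, Submodule.coe_smul, h1, smul_smul]
  congr 1
  push_cast
  rw [div_eq_mul_inv]

/-- Pass to the adjoint: the projection inside `creation` disappears against the symmetric vector
`f^{⊗(n+1)}`, and the first slot contributes `⟨g, f⟩`. -/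
lemma annihilation_tensPow (g : Lp C3 2 (volume : Measure R3)) (q p : HReal) (n : ℕ) :
    annihilation g n ⟨tensPow (cplx q p) (n + 1), tensPow_mem q p (n + 1)⟩ =
      (((Real.sqrt (n + 1) : ℝ) : ℂ) * inner ℂ g (cplx q p)) •
        (⟨tensPow (cplx q p) n, tensPow_mem q p n⟩ : symPow n) := by
  refine ext_inner_left ℂ fun w => ?_
  rw [annihilation, ContinuousLinearMap.adjoint_inner_right, creation_apply]
  simp only [Submodule.coe_inner, Submodule.coe_smul, inner_smul_left,
    inner_smul_right, Complex.conj_ofReal]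
  rw [mul_assoc]
  congr 1
  exact (Submodule.inner_orthogonalProjectionOnto_eq_of_mem_right
    (⟨_, tensPow_mem q p (n + 1)⟩ : symPow (n + 1)) (tens n g w)).trans (inner_tens _ _ _ _ _)

lemma norm_creation_apply_le (g : Lp C3 2 (volume : Measure R3)) (n : ℕ) (ψ : symPow n) :
    ‖creation g n ψ‖ ≤ Real.sqrt (n + 1) * (‖g‖ * ‖ψ‖) := by
  rw [creation_apply, norm_smul, Complex.norm_real, Real.norm_of_nonneg (Real.sqrt_nonneg _)]
  gcongr
  exact (Submodule.norm_orthogonalProjectionOnto_apply_le _ _).trans (norm_tens_le _ _ _)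

lemma creation_add (g g' : Lp C3 2 (volume : Measure R3)) (n : ℕ) (ψ : symPow n) :
    creation (g + g') n ψ = creation g n ψ + creation g' n ψ := by
  rw [creation_apply, creation_apply, creation_apply, tens_add_left, map_add, smul_add]

lemma creation_smul (z : ℂ) (g : Lp C3 2 (volume : Measure R3)) (n : ℕ) (ψ : symPow n) :
    creation (z • g) n ψ = z • creation g n ψ := by
  rw [creation_apply, creation_apply, tens_smul_left, map_smul, smul_comm]

/-! ### The complexification -/

lemma inner_complexify (v w : R3) :
    inner ℂ (complexify v) (complexify w) = ((inner ℝ v w : ℝ) : ℂ) := by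
  simp [complexify, PiLp.inner_apply]

lemma inner_compLpL_complexify (f g : Lp R3 2 (volume : Measure R3)) :
    inner ℂ (complexify.compLpL 2 (volume : Measure R3) f)
      (complexify.compLpL 2 (volume : Measure R3) g) = ((inner ℝ f g : ℝ) : ℂ) := by
  rw [L2.inner_def, L2.inner_def]
  refine (integral_congr_ae ?_).trans integral_ofReal
  filter_upwards [complexify.coeFn_compLpL (p := 2) (μ := (volume : Measure R3)) f,
    complexify.coeFn_compLpL (p := 2) (μ := (volume : Measure R3)) g] with k h1 h2
  rw [h1, h2, inner_complexify]
  rfl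

/-- The imaginary part is the symplectic form; it vanishes on the diagonal, and also on the pair
`(Mf, f)` by symmetry of `M`. -/
lemma inner_cplx (a b q p : HReal) :
    inner ℂ (cplx a b) (cplx q p) = ((inner ℝ a q + inner ℝ b p : ℝ) : ℂ) +
      Complex.I * ((inner ℝ a p - inner ℝ b q : ℝ) : ℂ) := by
  simp only [cplx, inner_add_left, inner_add_right, inner_smul_left, inner_smul_right,
    inner_compLpL_complexify, Complex.conj_I, Submodule.coe_inner]
  push_cast
  linear_combination (-(inner ℝ (b : Lp R3 2 (volume : Measure R3))
    (p : Lp R3 2 (volume : Measure R3)) : ℂ)) * Complex.I_sq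

lemma norm_cplx_sq (q p : HReal) : ‖cplx q p‖ ^ 2 = ‖q‖ ^ 2 + ‖p‖ ^ 2 := by
  rw [← inner_self_eq_norm_sq (𝕜 := ℂ), inner_cplx, real_inner_comm p q, sub_self,
    real_inner_self_eq_norm_sq, real_inner_self_eq_norm_sq, Complex.ofReal_zero, mul_zero, add_zero]
  exact Complex.ofReal_re _

lemma cplx_coeFn (q p : HReal) : ∀ᵐ k : R3, cplx q p k =
    complexify ((q : Lp R3 2 (volume : Measure R3)) k) +
      Complex.I • complexify ((p : Lp R3 2 (volume : Measure R3)) k) := by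
  filter_upwards [complexify.coeFn_compLpL (p := 2) (μ := (volume : Measure R3)) q.1,
    complexify.coeFn_compLpL (p := 2) (μ := (volume : Measure R3)) p.1,
    Lp.coeFn_add (complexify.compLpL 2 (volume : Measure R3) q.1)
      (Complex.I • complexify.compLpL 2 (volume : Measure R3) p.1),
    Lp.coeFn_smul Complex.I (complexify.compLpL 2 (volume : Measure R3) p.1)] with k h1 h2 h3 h4
  rw [cplx, h3, Pi.add_apply, h4, Pi.smul_apply, h1, h2]

/-! ### Norm bounds for coherent states -/

lemma Fock.norm_le_of_hasSum {Ψ : Fock} {u : ℕ → ℝ} {A S : ℝ} (hA : 0 ≤ A)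
    (hΨ : ∀ n, ‖Ψ n‖ ^ 2 ≤ u n) (hu : HasSum u S) (hS : S ≤ A ^ 2) : ‖Ψ‖ ≤ A := by
  refine lp.norm_le_of_forall_sum_le (by norm_num) hA fun s => ?_
  rw [ENNReal.toReal_ofNat]
  calc ∑ i ∈ s, ‖Ψ i‖ ^ (2 : ℝ) ≤ ∑ i ∈ s, u i := by
        gcongr with i
        exact_mod_cast hΨ i
    _ ≤ S := sum_le_hasSum s (fun i _ => (sq_nonneg _).trans (hΨ i)) hu
    _ ≤ A ^ (2 : ℝ) := by exact_mod_cast hS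

/-- The coefficient of `(q + i p)^{⊗ n}` in the coherent state. -/
def coherentCoeff (h : ℝ) (q p : HReal) (n : ℕ) : ℝ :=
  Real.exp (-(‖q‖ ^ 2 + ‖p‖ ^ 2) / (4 * h)) /
      ((2 * h) ^ ((n : ℝ) / 2) * Real.sqrt (n.factorial))

lemma coherent_apply (h : ℝ) (hh : 0 < h) (q p : HReal) (n : ℕ) :
    coherent h hh q p n = ((coherentCoeff h q p n : ℝ) : ℂ) •
      (⟨tensPow (cplx q p) n, tensPow_mem q p n⟩ : symPow n) := rfl

/-- This ratio makes coherent states eigenvectors: its `√(n + 1)` cancels the one in the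
annihilation operator. -/
lemma coherentCoeff_succ {h : ℝ} (hh : 0 < h) (q p : HReal) (n : ℕ) :
    coherentCoeff h q p (n + 1) =
      coherentCoeff h q p n / (Real.sqrt (2 * h) * Real.sqrt (n + 1)) := by
  have h1 : (2 * h) ^ (((n + 1 : ℕ) : ℝ) / 2) = (2 * h) ^ ((n : ℝ) / 2) * Real.sqrt (2 * h) := by
    rw [Real.sqrt_eq_rpow, ← Real.rpow_add (by positivity)]
    congr 1
    push_cast
    ring
  have h2 : Real.sqrt ((n + 1).factorial) = Real.sqrt (n + 1) * Real.sqrt (n.factorial) := by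
    rw [← Real.sqrt_mul (by positivity), Nat.factorial_succ]
    push_cast
    rfl
  rw [coherentCoeff, coherentCoeff, h1, h2, div_div]
  congr 1
  ring

lemma coherentCoeff_nonneg {h : ℝ} (hh : 0 < h) (q p : HReal) (n : ℕ) :
    0 ≤ coherentCoeff h q p n := by
  unfold coherentCoeff
  positivity

lemma coherentCoeff_sq {h : ℝ} (hh : 0 < h) (q p : HReal) (n : ℕ) :
    coherentCoeff h q p n ^ 2 =
      Real.exp (-(‖cplx q p‖ ^ 2 / (2 * h))) / ((2 * h) ^ n * n.factorial) := by
  have h2 : ((2 * h) ^ ((n : ℝ) / 2)) ^ 2 = (2 * h) ^ n := by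
    rw [← Real.rpow_natCast, ← Real.rpow_mul (by positivity), ← Real.rpow_natCast]
    congr 1
    push_cast
    ring
  rw [coherentCoeff, div_pow, mul_pow, h2, Real.sq_sqrt (by positivity), ← Real.exp_nat_mul,
    norm_cplx_sq]
  congr 2
  push_cast
  field_simp
  ring

/-- The particle number follows a Poisson law of parameter `‖f‖² / (2h)`, up to the factor `‖vac‖²`,
whose value is never needed. -/
lemma norm_coherent_apply_sq_le {h : ℝ} (hh : 0 < h) (q p : HReal) (n : ℕ) :
    ‖coherent h hh q p n‖ ^ 2 ≤ ‖vac‖ ^ 2 * Real.exp (-(‖cplx q p‖ ^ 2 / (2 * h))) *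
      ((‖cplx q p‖ ^ 2 / (2 * h)) ^ n / n.factorial) := by
  have h1 : ‖coherent h hh q p n‖ ≤ coherentCoeff h q p n * (‖vac‖ * ‖cplx q p‖ ^ n) := by
    rw [coherent_apply, norm_smul, Complex.norm_real,
      Real.norm_of_nonneg (coherentCoeff_nonneg hh q p n)]
    exact mul_le_mul_of_nonneg_left (norm_tensPow_le _ n) (coherentCoeff_nonneg hh q p n)
  calc _ ≤ (coherentCoeff h q p n * (‖vac‖ * ‖cplx q p‖ ^ n)) ^ 2 := by gcongr
    _ = _ := by
      rw [mul_pow, coherentCoeff_sq hh, div_pow, mul_pow ‖vac‖, ← pow_mul, ← pow_mul, mul_comm n 2]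
      field_simp

lemma hasSum_pow_div_factorial (r : ℝ) :
    HasSum (fun n : ℕ => r ^ n / n.factorial) (Real.exp r) := by
  rw [Real.exp_eq_exp_ℝ]
  exact NormedSpace.expSeries_div_hasSum_exp r

/-- The mean of `n + 1` under a Poisson law of parameter `r` is `r + 1`. -/
lemma hasSum_succ_mul_pow_div_factorial (r : ℝ) :
    HasSum (fun n : ℕ => ((n : ℝ) + 1) * (r ^ n / n.factorial)) ((r + 1) * Real.exp r) := by
  have h1 : HasSum (fun n : ℕ => (n : ℝ) * (r ^ n / n.factorial)) (r * Real.exp r) := by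
    -- The term at `0` vanishes, and after the shift `(n + 1) / (n + 1)!` reduces to `1 / n!`.
    rw [← hasSum_nat_add_iff' 1]
    simp only [Finset.range_one, Finset.sum_singleton, Nat.cast_zero, zero_mul, sub_zero]
    refine ((hasSum_pow_div_factorial r).mul_left r).congr_fun fun n => ?_
    rw [Nat.factorial_succ]
    push_cast
    field_simp
    ring
  rw [add_mul, one_mul]
  exact (h1.add (hasSum_pow_div_factorial r)).congr_fun fun n => by ring

lemma norm_coherent_le {h : ℝ} (hh : 0 < h) (q p : HReal) : ‖coherent h hh q p‖ ≤ ‖vac‖ := by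
  refine Fock.norm_le_of_hasSum (norm_nonneg _) (norm_coherent_apply_sq_le hh q p)
    ((hasSum_pow_div_factorial _).mul_left _) (le_of_eq ?_)
  rw [mul_assoc, ← Real.exp_add, neg_add_cancel, Real.exp_zero, mul_one]

lemma vac_ne_zero : vac ≠ 0 := by
  intro h
  have h1 := (memLp_const (μ := (volume : Measure (Fin 0 → R3)))
    (WithLp.toLp 2 (fun _ => 1) : EuclideanSpace ℂ (Fin 0 → Fin 3)) (p := 2)).coeFn_toLp
  have h3 : ∀ᵐ _ : Fin 0 → R3, False := by
    filter_upwards [h1, Lp.coeFn_zero (EuclideanSpace ℂ (Fin 0 → Fin 3)) 2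
      (volume : Measure (Fin 0 → R3))] with k h2 h3
    have h4 : (0 : TensorL2 0) k = WithLp.toLp 2 (fun _ => 1) := h ▸ h2
    rw [h3] at h4
    simpa using congrArg (fun v : EuclideanSpace ℂ (Fin 0 → Fin 3) => v Fin.elim0) h4
  rw [Filter.eventually_false_iff_eq_bot, ae_eq_bot] at h3
  -- The configuration space of zero particles is a single point of mass one, so "almost everywhere"
  -- there is not vacuous.
  have h4 : (volume : Measure (Fin 0 → R3)) Set.univ = 1 := by
    rw [volume_pi, Measure.pi_of_empty _ Fin.elim0]
    simp
  rw [h3] at h4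
  simp at h4

/-- The vacuum component is a positive multiple of `vac`. -/
lemma coherent_ne_zero {h : ℝ} (hh : 0 < h) (q p : HReal) : coherent h hh q p ≠ 0 := by
  intro h0
  have h1 : (coherent h hh q p 0 : TensorL2 0) = 0 := by rw [h0]; rfl
  rw [coherent_apply, Submodule.coe_smul, smul_eq_zero] at h1
  rcases h1 with h1 | h1
  · have h2 : 0 < coherentCoeff h q p 0 := by
      unfold coherentCoeff
      positivity
    exact h2.ne' (by exact_mod_cast h1)
  · exact vac_ne_zero h1

/-! ### Field operators on coherent states -/

/-- The components of `a*(g) Ψ`, for a coherent state `Ψ`. -/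
def creationCoherentComp (h : ℝ) (hh : 0 < h) (q p : HReal) (g : Lp C3 2 (volume : Measure R3)) :
    (n : ℕ) → symPow n
  | 0 => 0
  | n + 1 => creation g n (coherent h hh q p n)

/-- A sequence dominating the squared norms of the components of `a*(g) Ψ`. -/
def creationCoherentBound (h : ℝ) (q p : HReal) (g : Lp C3 2 (volume : Measure R3)) : ℕ → ℝ
  | 0 => 0
  | n + 1 => ‖g‖ ^ 2 * (‖vac‖ ^ 2 * Real.exp (-(‖cplx q p‖ ^ 2 / (2 * h)))) *
      (((n : ℝ) + 1) * ((‖cplx q p‖ ^ 2 / (2 * h)) ^ n / n.factorial))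

lemma norm_creationCoherentComp_sq_le {h : ℝ} (hh : 0 < h) (q p : HReal)
    (g : Lp C3 2 (volume : Measure R3)) (n : ℕ) :
    ‖creationCoherentComp h hh q p g n‖ ^ 2 ≤ creationCoherentBound h q p g n := by
  cases n with
  | zero => simp [creationCoherentComp, creationCoherentBound]
  | succ n =>
    simp only [creationCoherentComp, creationCoherentBound]
    calc _ ≤ (Real.sqrt (n + 1) * (‖g‖ * ‖coherent h hh q p n‖)) ^ 2 := by
          gcongr
          exact norm_creation_apply_le g n _
      _ = (n + 1) * ‖g‖ ^ 2 * ‖coherent h hh q p n‖ ^ 2 := by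
          rw [mul_pow, Real.sq_sqrt (by positivity)]
          ring
      _ ≤ (n + 1) * ‖g‖ ^ 2 * (‖vac‖ ^ 2 * Real.exp (-(‖cplx q p‖ ^ 2 / (2 * h))) *
            ((‖cplx q p‖ ^ 2 / (2 * h)) ^ n / n.factorial)) := by
          gcongr
          exact norm_coherent_apply_sq_le hh q p n
      _ = _ := by ring

/-- The squared factor `√(n + 1)` of creation produces the Poisson mean of `n + 1`. -/
lemma hasSum_creationCoherentBound (h : ℝ) (q p : HReal) (g : Lp C3 2 (volume : Measure R3)) :
    HasSum (creationCoherentBound h q p g)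
      (‖g‖ ^ 2 * ‖vac‖ ^ 2 * (1 + ‖cplx q p‖ ^ 2 / (2 * h))) := by
  rw [← hasSum_nat_add_iff' 1]
  simp only [Finset.range_one, Finset.sum_singleton, creationCoherentBound, sub_zero]
  have h1 : ‖g‖ ^ 2 * ‖vac‖ ^ 2 * (1 + ‖cplx q p‖ ^ 2 / (2 * h)) =
      ‖g‖ ^ 2 * (‖vac‖ ^ 2 * Real.exp (-(‖cplx q p‖ ^ 2 / (2 * h)))) *
        ((‖cplx q p‖ ^ 2 / (2 * h) + 1) * Real.exp (‖cplx q p‖ ^ 2 / (2 * h))) := by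
    have h2 : Real.exp (-(‖cplx q p‖ ^ 2 / (2 * h))) * Real.exp (‖cplx q p‖ ^ 2 / (2 * h)) = 1 := by
      rw [← Real.exp_add, neg_add_cancel, Real.exp_zero]
    linear_combination (-(‖g‖ ^ 2 * ‖vac‖ ^ 2 * (1 + ‖cplx q p‖ ^ 2 / (2 * h)))) * h2
  rw [h1]
  exact (hasSum_succ_mul_pow_div_factorial (‖cplx q p‖ ^ 2 / (2 * h))).mul_left _

lemma memℓp_creationCoherentComp {h : ℝ} (hh : 0 < h) (q p : HReal)
    (g : Lp C3 2 (volume : Measure R3)) : Memℓp (creationCoherentComp h hh q p g) 2 := by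
  rw [memℓp_gen_iff (by norm_num)]
  refine Summable.of_nonneg_of_le (fun n => by positivity) (fun n => ?_)
    (hasSum_creationCoherentBound h q p g).summable
  rw [ENNReal.toReal_ofNat]
  exact_mod_cast norm_creationCoherentComp_sq_le hh q p g n

/-- The vector `a*(g) Ψ`, for a coherent state `Ψ`, as a linear function of `g`. -/
def creationCoherent (h : ℝ) (hh : 0 < h) (q p : HReal) :
    Lp C3 2 (volume : Measure R3) →ₗ[ℂ] Fock where
  toFun g := ⟨creationCoherentComp h hh q p g, memℓp_creationCoherentComp hh q p g⟩
  map_add' g g' := by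
    apply lp.ext
    funext n
    cases n with
    | zero => exact (add_zero _).symm
    | succ n => exact creation_add g g' n _
  map_smul' z g := by
    apply lp.ext
    funext n
    cases n with
    | zero => exact (smul_zero z).symm
    | succ n => exact creation_smul z g n _

lemma norm_creationCoherent_le {h : ℝ} (hh : 0 < h) (q p : HReal)
    (g : Lp C3 2 (volume : Measure R3)) :
    ‖creationCoherent h hh q p g‖ ≤
      ‖g‖ * ‖vac‖ * Real.sqrt (1 + ‖cplx q p‖ ^ 2 / (2 * h)) := by
  refine Fock.norm_le_of_hasSum (by positivity) (norm_creationCoherentComp_sq_le hh q p g)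
    (hasSum_creationCoherentBound h q p g) (le_of_eq ?_)
  rw [mul_pow, mul_pow, Real.sq_sqrt (by positivity)]

lemma annihilation_coherent {h : ℝ} (hh : 0 < h) (q p : HReal)
    (g : Lp C3 2 (volume : Measure R3)) (n : ℕ) :
    annihilation g n (coherent h hh q p (n + 1)) =
      (inner ℂ g (cplx q p) / ((Real.sqrt (2 * h) : ℝ) : ℂ)) • coherent h hh q p n := by
  have h1 : ((Real.sqrt ((n : ℝ) + 1) : ℝ) : ℂ) ≠ 0 := by
    exact_mod_cast (Real.sqrt_pos.2 (by positivity)).ne'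
  rw [coherent_apply, coherent_apply, map_smul, annihilation_tensPow, smul_smul, smul_smul,
    coherentCoeff_succ hh]
  congr 1
  push_cast
  field_simp

/-- Both halves of the field are square summable on a coherent state, which therefore lies in the
maximal domain for every `g`. -/
lemma coherent_mem_fieldGraph {h : ℝ} (hh : 0 < h) (q p : HReal)
    (g : Lp C3 2 (volume : Measure R3)) :
    (coherent h hh q p, (inner ℂ g (cplx q p) / ((Real.sqrt (2 * h) : ℝ) : ℂ)) •
      coherent h hh q p + creationCoherent h hh q p g) ∈ fieldGraph g := by
  intro n
  cases n with
  | zero =>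
    exact (add_zero _).trans (annihilation_coherent hh q p g 0).symm
  | succ n =>
    exact congrArg (· + creation g n (coherent h hh q p n))
      (annihilation_coherent hh q p g (n + 1)).symm

/-- On `f^{⊗(n+1)}` multiplication by `∑ |k_j|` inserts `Mf` in each slot, which is `√(n+1) a*(Mf)`
applied to `f^{⊗n}`; the coefficient ratio replaces `√(n+1)` by `(2h)^{-1/2}`. Only `f ∈ D(M)` is
needed. -/
lemma coherent_mem_dGammaGraph {h : ℝ} (hh : 0 < h) {q p q' p' : HReal}
    (hq : ∀ᵐ k : R3, (q' : Lp R3 2 (volume : Measure R3)) k =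
      ‖k‖ • (q : Lp R3 2 (volume : Measure R3)) k)
    (hp : ∀ᵐ k : R3, (p' : Lp R3 2 (volume : Measure R3)) k =
      ‖k‖ • (p : Lp R3 2 (volume : Measure R3)) k) :
    (coherent h hh q p, ((Real.sqrt (2 * h) : ℝ) : ℂ)⁻¹ •
      creationCoherent h hh q p (cplx q' p')) ∈ dGammaGraph := by
  have hu : ∀ᵐ k : R3, cplx q' p' k = (‖k‖ : ℂ) • cplx q p k := by
    filter_upwards [hq, hp, cplx_coeFn q p, cplx_coeFn q' p'] with k h1 h2 h3 h4
    rw [h4, h3, h1, h2, map_smul, map_smul]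
    ext i
    simp
    ring
  intro n
  cases n with
  | zero =>
    have h1 : ((((Real.sqrt (2 * h) : ℝ) : ℂ)⁻¹ •
      creationCoherent h hh q p (cplx q' p') : Fock) 0 : TensorL2 0) = 0 := smul_zero _
    refine Filter.Eventually.of_forall fun k => ?_
    simp only [Finset.univ_eq_empty, Finset.sum_empty, zero_smul, h1]
    simp
  | succ n =>
    have h1 : ((((Real.sqrt (2 * h) : ℝ) : ℂ)⁻¹ •
        creationCoherent h hh q p (cplx q' p') : Fock) (n + 1) : TensorL2 (n + 1)) =
        ((coherentCoeff h q p (n + 1) : ℝ) : ℂ) •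
          tensPowDeriv (cplx q p) (cplx q' p') (n + 1) := by
      change ((Real.sqrt (2 * h) : ℝ) : ℂ)⁻¹ •
        (creation (cplx q' p') n (coherent h hh q p n) : TensorL2 (n + 1)) = _
      rw [coherent_apply, map_smul, Submodule.coe_smul, creation_tensPow, smul_smul, smul_smul,
        coherentCoeff_succ hh]
      congr 1
      rw [← Complex.ofReal_inv, ← Complex.ofReal_mul, ← Complex.ofReal_mul]
      congr 1
      have h2 : Real.sqrt ((n : ℝ) + 1) ^ 2 = n + 1 := Real.sq_sqrt (by positivity)
      have h3 : 0 < Real.sqrt ((n : ℝ) + 1) := Real.sqrt_pos.2 (by positivity)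
      have h4 : 0 < Real.sqrt (2 * h) := Real.sqrt_pos.2 (by positivity)
      nth_rewrite 2 [← h2]
      field_simp
    have h5 : ((coherent h hh q p (n + 1) : symPow (n + 1)) : TensorL2 (n + 1)) =
      ((coherentCoeff h q p (n + 1) : ℝ) : ℂ) • tensPow (cplx q p) (n + 1) := rfl
    simp only [h1, h5]
    filter_upwards [tensPowDeriv_ae_eq hu (n + 1),
      Lp.coeFn_smul ((coherentCoeff h q p (n + 1) : ℝ) : ℂ) (tensPow (cplx q p) (n + 1)),
      Lp.coeFn_smul ((coherentCoeff h q p (n + 1) : ℝ) : ℂ)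
        (tensPowDeriv (cplx q p) (cplx q' p') (n + 1))] with k h6 h7 h8
    rw [h7, h8, Pi.smul_apply, Pi.smul_apply, h6, smul_comm]

/-! ### The operator `M` -/

/-- The weight `|k|` vanishes only at the origin, a null set. -/
lemma freqMulGraph_injective {u : HReal} (h : (u, (0 : HReal)) ∈ freqMulGraph) : u = 0 := by
  have h1 : ∀ᵐ k : R3, ((0 : HReal) : Lp R3 2 (volume : Measure R3)) k =
    ‖k‖ • (u : Lp R3 2 (volume : Measure R3)) k := h
  have h0 : ∀ᵐ k : R3, k ≠ 0 := by simp [ae_iff]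
  apply Subtype.ext
  apply Lp.ext
  filter_upwards [h1, h0, Lp.coeFn_zero R3 2 (volume : Measure R3)] with k h2 h3 h4
  rw [ZeroMemClass.coe_zero, h4, Pi.zero_apply] at h2
  rw [ZeroMemClass.coe_zero, h4, Pi.zero_apply]
  exact (smul_eq_zero.1 h2.symm).resolve_left (norm_ne_zero_iff.2 h3)

lemma freqMul_inner_comm {q p u v : HReal} (hq : (q, u) ∈ freqMulGraph)
    (hp : (p, v) ∈ freqMulGraph) : inner ℝ u p = inner ℝ v q := by
  have hq' : ∀ᵐ k : R3, (u : Lp R3 2 (volume : Measure R3)) k =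
    ‖k‖ • (q : Lp R3 2 (volume : Measure R3)) k := hq
  have hp' : ∀ᵐ k : R3, (v : Lp R3 2 (volume : Measure R3)) k =
    ‖k‖ • (p : Lp R3 2 (volume : Measure R3)) k := hp
  rw [Submodule.coe_inner, Submodule.coe_inner, L2.inner_def, L2.inner_def]
  apply integral_congr_ae
  filter_upwards [hq', hp'] with k h1 h2
  rw [h1, h2, inner_smul_left, inner_smul_left, real_inner_comm]

lemma two_mul_photonEnergy {q p u v : HReal} (hq : (q, u) ∈ freqMulGraph)
    (hp : (p, v) ∈ freqMulGraph) : 2 * photonEnergy q p = inner ℝ u q + inner ℝ v p := by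
  have hq' : ∀ᵐ k : R3, (u : Lp R3 2 (volume : Measure R3)) k =
    ‖k‖ • (q : Lp R3 2 (volume : Measure R3)) k := hq
  have hp' : ∀ᵐ k : R3, (v : Lp R3 2 (volume : Measure R3)) k =
    ‖k‖ • (p : Lp R3 2 (volume : Measure R3)) k := hp
  rw [photonEnergy, Submodule.coe_inner, Submodule.coe_inner, L2.inner_def, L2.inner_def,
    ← integral_add (L2.integrable_inner _ _) (L2.integrable_inner _ _), ← mul_assoc,
    mul_one_div_cancel two_ne_zero, one_mul]
  apply integral_congr_ae
  filter_upwards [hq', hp'] with k h1 h2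
  rw [h1, h2, inner_smul_left, inner_smul_left, real_inner_self_eq_norm_sq,
    real_inner_self_eq_norm_sq, mul_add]
  rfl

/-- Real because `M` is symmetric; this is what makes the scalar in the eigenvalue equation real. -/
lemma inner_cplx_freqMul {q p u v : HReal} (hq : (q, u) ∈ freqMulGraph)
    (hp : (p, v) ∈ freqMulGraph) :
    inner ℂ (cplx u v) (cplx q p) = ((2 * photonEnergy q p : ℝ) : ℂ) := by
  rw [inner_cplx, freqMul_inner_comm hq hp, sub_self, Complex.ofReal_zero, mul_zero, add_zero,
    two_mul_photonEnergy hq hp]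

/-! ### Infrared regularity: the form factors lie in the range of `M` -/

lemma integrable_schwartz_sq_mul_norm_inv (χ : 𝓢(ℝ, ℝ)) :
    Integrable (fun k : R3 => χ ‖k‖ ^ 2 * ‖k‖⁻¹) := by
  -- In polar coordinates the weight `r²` absorbs `r⁻¹`, leaving `r χ(r)²`, bounded by `C r |χ(r)|`.
  rw [integrable_fun_norm_addHaar (volume : Measure R3) (f := fun r => χ r ^ 2 * r⁻¹)]
  obtain ⟨C, hC⟩ := χ.decay 0 0
  have h1 : Integrable (fun r : ℝ => C * (‖r‖ ^ 1 * ‖χ r‖)) :=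
    (χ.integrable_pow_mul volume 1).const_mul C
  refine h1.integrableOn.mono' ?_ ?_
  · apply Measurable.aestronglyMeasurable
    have := χ.continuous.measurable
    fun_prop
  · filter_upwards [ae_restrict_mem measurableSet_Ioi] with r hr
    have hr' : (0 : ℝ) < r := hr
    have h2 := hC.2 r
    rw [pow_zero, one_mul, norm_iteratedFDeriv_zero] at h2
    have h3 : r ^ 2 * (χ r ^ 2 * r⁻¹) = |χ r| * (r * |χ r|) := by
      rw [← sq_abs (χ r)]
      field_simp
    rw [finrank_euclideanSpace_fin, smul_eq_mul, h3, Real.norm_of_nonneg (by positivity),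
      Real.norm_of_nonneg hr'.le, pow_one]
    exact mul_le_mul_of_nonneg_right h2 (by positivity)

/-- The form factor is bounded by `|χ| |k|^{1/2}`, so after division by `|k|` its square is at most
`χ² |k|⁻¹`. -/
lemma memLp_norm_inv_smul_fieldFun (χ : 𝓢(ℝ, ℝ)) (s : ℝ → ℝ) (hc : Continuous s)
    (hs : ∀ t, |s t| ≤ 1) (x : R3) (m : Fin 3) :
    MemLp (fun k => ‖k‖⁻¹ • fieldFun χ s x m k) 2 (volume : Measure R3) := by
  have hm : AEStronglyMeasurable (fun k => ‖k‖⁻¹ • fieldFun χ s x m k) (volume : Measure R3) :=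
    measurable_norm.inv.aestronglyMeasurable.smul (memLp_fieldFun χ s hc hs x m).1
  rw [memLp_two_iff_integrable_sq_norm hm]
  refine (integrable_schwartz_sq_mul_norm_inv χ).mono' (hm.norm.pow 2)
    (Filter.Eventually.of_forall fun k => ?_)
  rw [Real.norm_of_nonneg (by positivity), norm_smul, norm_inv, norm_norm]
  calc (‖k‖⁻¹ * ‖fieldFun χ s x m k‖) ^ 2 ≤ (‖k‖⁻¹ * (|χ ‖k‖| * ‖k‖ ^ (1 / 2 : ℝ))) ^ 2 := by
        gcongr
        exact norm_fieldFun_le χ s hs x m k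
    _ = χ ‖k‖ ^ 2 * ‖k‖⁻¹ := by
        have h1 : (‖k‖ ^ (1 / 2 : ℝ)) ^ 2 = ‖k‖ := by
          rw [← Real.sqrt_eq_rpow, Real.sq_sqrt (norm_nonneg k)]
        rw [mul_pow, mul_pow, h1, sq_abs]
        rcases eq_or_ne ‖k‖ 0 with h0 | h0
        · simp [h0]
        · field_simp

lemma exists_mem_freqMulGraph_fieldFun (χ : 𝓢(ℝ, ℝ)) (s : ℝ → ℝ) (hc : Continuous s)
    (hs : ∀ t, |s t| ≤ 1) (x : R3) (m : Fin 3) :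
    ∃ u : HReal, (u, (⟨_, fieldFun_mem χ s hc hs x m⟩ : HReal)) ∈ freqMulGraph := by
  have h1 := (memLp_norm_inv_smul_fieldFun χ s hc hs x m).coeFn_toLp
  have h2 := (memLp_fieldFun χ s hc hs x m).coeFn_toLp
  have h3 : ∀ᵐ k : R3, inner ℝ k ((memLp_fieldFun χ s hc hs x m).toLp _ k) = 0 :=
    fieldFun_mem χ s hc hs x m
  have h0 : ∀ᵐ k : R3, k ≠ 0 := by simp [ae_iff]
  refine ⟨⟨(memLp_norm_inv_smul_fieldFun χ s hc hs x m).toLp _, ?_⟩, ?_⟩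
  · change ∀ᵐ k : R3, _
    filter_upwards [h1, h2, h3] with k h4 h5 h6
    rw [h4, inner_smul_right, ← h5, h6, mul_zero]
  · change ∀ᵐ k : R3, _
    filter_upwards [h0, h1, h2] with k h3 h4 h5
    rw [h4, h5, smul_smul, mul_inv_cancel₀ (norm_ne_zero_iff.2 h3), one_smul]

lemma exists_mem_freqMulGraph_fieldA (χ : 𝓢(ℝ, ℝ)) (x : R3) (m : Fin 3) :
    ∃ u : HReal, (u, fieldA χ x m) ∈ freqMulGraph :=
  exists_mem_freqMulGraph_fieldFun χ Real.sin Real.continuous_sin Real.abs_sin_le_one x m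

lemma exists_mem_freqMulGraph_fieldB (χ : 𝓢(ℝ, ℝ)) (x : R3) (m : Fin 3) :
    ∃ u : HReal, (u, fieldB χ x m) ∈ freqMulGraph :=
  exists_mem_freqMulGraph_fieldFun χ Real.cos Real.continuous_cos Real.abs_cos_le_one x m

/-- Injectivity of `M` allows the relation for `Mq` to be solved for `q` in terms of fixed
preimages. -/
lemma freqMulGraph_eq_sum {N : ℕ} {q : HReal} {r : ℝ} {c : Fin N → Fin 3 → ℝ}
    {u v : Fin N → Fin 3 → HReal} (huv : ∀ l m, (u l m, v l m) ∈ freqMulGraph)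
    (hq : (q, r • ∑ l, ∑ m, c l m • v l m) ∈ freqMulGraph) :
    q = r • ∑ l, ∑ m, c l m • u l m := by
  have h1 : r • ∑ l, ∑ m, c l m • (u l m, v l m) ∈ freqMulGraph :=
    Submodule.smul_mem _ _ (Submodule.sum_mem _ fun l _ => Submodule.sum_mem _ fun m _ =>
      Submodule.smul_mem _ _ (huv l m))
  have h2 := Submodule.sub_mem _ hq h1
  have h3 : (q, r • ∑ l, ∑ m, c l m • v l m) - r • ∑ l, ∑ m, c l m • (u l m, v l m) =
      (q - r • ∑ l, ∑ m, c l m • u l m, 0) := by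
    ext1 <;> simp [Prod.fst_sum, Prod.snd_sum]
  rw [h3] at h2
  exact sub_eq_zero.1 (freqMulGraph_injective h2)

lemma norm_sum_smul_le {N : ℕ} {E : Type*} [SeminormedAddCommGroup E] [NormedSpace ℝ E]
    {c κ : Fin N → Fin 3 → ℝ} (hc : ∀ l m, |c l m| ≤ κ l m) (u : Fin N → Fin 3 → E) :
    ‖∑ l, ∑ m, c l m • u l m‖ ≤ ∑ l, ∑ m, κ l m * ‖u l m‖ := by
  refine (norm_sum_le _ _).trans (Finset.sum_le_sum fun l _ => ?_)
  refine (norm_sum_le _ _).trans (Finset.sum_le_sum fun m _ => ?_)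
  rw [norm_smul, Real.norm_eq_abs]
  exact mul_le_mul_of_nonneg_right (hc l m) (norm_nonneg _)

/-! ### Stationary points -/

/-- Both derivatives of a constant curve vanish: together these relations read `Mf = -h ∑ ω_{l,m}
g_{l,m}`. -/
lemma IsStationaryPoint.mem_freqMulGraph {N : ℕ} {h : ℝ} {χ : 𝓢(ℝ, ℝ)} {x : Fin N → R3} {β : R3}
    {q p : HReal} {ω : Module.Dual ℝ (suLie N)} (hst : IsStationaryPoint h χ x β q p ω) :
    (q, (-h) • ∑ l, ∑ m, ω (iSigma l m) • fieldA χ (x l) m) ∈ freqMulGraph ∧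
      (p, (-h) • ∑ l, ∑ m, ω (iSigma l m) • fieldB χ (x l) m) ∈ freqMulGraph := by
  obtain ⟨hq, hp, h1, h2, -⟩ := hst 0
  have h3 := h1.unique (hasDerivAt_const (0 : ℝ) q)
  have h4 := h2.unique (hasDerivAt_const (0 : ℝ) p)
  have h5 : freqMul ⟨q, hq⟩ = (-h) • ∑ l, ∑ m, ω (iSigma l m) • fieldA χ (x l) m := by
    rw [neg_smul]
    exact neg_eq_iff_eq_neg.1 (sub_eq_zero.1 h4)
  have h6 : freqMul ⟨p, hp⟩ = (-h) • ∑ l, ∑ m, ω (iSigma l m) • fieldB χ (x l) m := by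
    rw [neg_smul]
    exact eq_neg_of_add_eq_zero_left h3
  constructor
  · rw [← h5]
    exact Submodule.mem_graph_toLinearPMap freqMulGraph_functional ⟨q, hq⟩
  · rw [← h6]
    exact Submodule.mem_graph_toLinearPMap freqMulGraph_functional ⟨p, hp⟩

/-- The element `a_m(x) + i b_m(x)` of the complexified one-particle space. -/
def fieldCplx (χ : 𝓢(ℝ, ℝ)) (x : R3) (m : Fin 3) : Lp C3 2 (volume : Measure R3) :=
  cplx (fieldA χ x m) (fieldB χ x m)

lemma cplx_sum {ι : Type*} (s : Finset ι) (u v : ι → HReal) :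
    cplx (∑ i ∈ s, u i) (∑ i ∈ s, v i) = ∑ i ∈ s, cplx (u i) (v i) := by
  classical
  induction s using Finset.induction_on with
  | empty => simp [cplx]
  | insert i s hi ih => rw [Finset.sum_insert hi, Finset.sum_insert hi, Finset.sum_insert hi,
      cplx_add, ih]

lemma cplx_smul_sum_field {N : ℕ} (χ : 𝓢(ℝ, ℝ)) (x : Fin N → R3) (r : ℝ)
    (c : Fin N → Fin 3 → ℝ) :
    cplx (r • ∑ l, ∑ m, c l m • fieldA χ (x l) m) (r • ∑ l, ∑ m, c l m • fieldB χ (x l) m) =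
      (r : ℂ) • ∑ l, ∑ m, (c l m : ℂ) • fieldCplx χ (x l) m := by
  rw [cplx_real_smul, cplx_sum]
  simp_rw [cplx_sum, cplx_real_smul]
  rfl

lemma re_inner_fieldCplx (χ : 𝓢(ℝ, ℝ)) (x : R3) (m : Fin 3) (q p : HReal) :
    (inner ℂ (fieldCplx χ x m) (cplx q p)).re = magSymbol χ x m q p := by
  rw [fieldCplx, inner_cplx]
  simp [magSymbol]

/-- Inner product of the stationarity relation with `f`, using `⟨Mf, f⟩ = 2 H_ph(q,p)`. -/
lemma IsStationaryPoint.sum_inner_field {N : ℕ} {h : ℝ} {χ : 𝓢(ℝ, ℝ)} {x : Fin N → R3} {β : R3}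
    {q p : HReal} {ω : Module.Dual ℝ (suLie N)} (hst : IsStationaryPoint h χ x β q p ω) :
    (h : ℂ) * ∑ l, ∑ m, (ω (iSigma l m) : ℂ) * inner ℂ (fieldCplx χ (x l) m) (cplx q p) =
      ((-2 * photonEnergy q p : ℝ) : ℂ) := by
  obtain ⟨hq, hp⟩ := hst.mem_freqMulGraph
  have h1 := inner_cplx_freqMul hq hp
  rw [cplx_smul_sum_field χ x (-h) (fun l m => ω (iSigma l m)), inner_smul_left,
    Complex.conj_ofReal] at h1
  have h2 : inner ℂ (∑ l, ∑ m, (ω (iSigma l m) : ℂ) • fieldCplx χ (x l) m) (cplx q p) =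
      ∑ l, ∑ m, (ω (iSigma l m) : ℂ) * inner ℂ (fieldCplx χ (x l) m) (cplx q p) := by
    rw [sum_inner]
    refine Finset.sum_congr rfl fun l _ => ?_
    rw [sum_inner]
    refine Finset.sum_congr rfl fun m _ => ?_
    rw [inner_smul_left, Complex.conj_ofReal]
  rw [h2, Complex.ofReal_neg, neg_mul] at h1
  rw [neg_mul, Complex.ofReal_neg, ← h1, neg_neg]

lemma IsStationaryPoint.sum_magSymbol {N : ℕ} {h : ℝ} {χ : 𝓢(ℝ, ℝ)} {x : Fin N → R3} {β : R3}
    {q p : HReal} {ω : Module.Dual ℝ (suLie N)} (hst : IsStationaryPoint h χ x β q p ω) :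
    h * ∑ l, ∑ m, ω (iSigma l m) * magSymbol χ (x l) m q p = -2 * photonEnergy q p := by
  have h1 := congrArg Complex.re hst.sum_inner_field
  rw [Complex.re_ofReal_mul, Complex.ofReal_re, Complex.re_sum] at h1
  simp_rw [Complex.re_sum, Complex.re_ofReal_mul, re_inner_fieldCplx] at h1
  exact h1

/-- At a stationary point the field interaction contributes `-2 H_ph(q,p)`, so the free energy
changes sign. -/
lemma IsStationaryPoint.classicalHam_eq {N : ℕ} {h : ℝ} {χ : 𝓢(ℝ, ℝ)} {x : Fin N → R3} {β : R3}
    {q p : HReal} {ω : Module.Dual ℝ (suLie N)} (hst : IsStationaryPoint h χ x β q p ω) :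
    classicalHam h χ x β q p ω =
      h * ∑ l, ∑ m, ω (iSigma l m) * β m - photonEnergy q p := by
  have h1 : ∑ l, ∑ m, (β m + magSymbol χ (x l) m q p) * ω (iSigma l m) =
      ∑ l, ∑ m, ω (iSigma l m) * β m +
        ∑ l, ∑ m, ω (iSigma l m) * magSymbol χ (x l) m q p := by
    simp_rw [← Finset.sum_add_distrib]
    exact Finset.sum_congr rfl fun l _ => Finset.sum_congr rfl fun m _ => by ring
  rw [classicalHam, h1]
  linear_combination hst.sum_magSymbol

end SpinPhoton

end

noncomputable section

/-! ### Graphs of sums of partially defined linear maps -/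

namespace LinearPMap

variable {R E F : Type*} [Ring R] [AddCommGroup E] [Module R E] [AddCommGroup F] [Module R F]

/-- Graph membership records the domain condition and the value together, which lets sums of
unbounded operators be handled without carrying domain proofs. -/
lemma exists_apply_eq_of_mem_graph {T : E →ₗ.[R] F} {x : E} {y : F} (h : (x, y) ∈ T.graph) :
    ∃ hx : x ∈ T.domain, T ⟨x, hx⟩ = y := by
  obtain ⟨⟨x', hx⟩, h1, h2⟩ := (LinearPMap.mem_graph_iff T).1 h
  obtain rfl : x' = x := h1
  exact ⟨hx, h2⟩

lemma mem_graph_of_apply_eq {T : E →ₗ.[R] F} {x : E} {y : F} (hx : x ∈ T.domain)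
    (h : T ⟨x, hx⟩ = y) : (x, y) ∈ T.graph :=
  (LinearPMap.mem_graph_iff T).2 ⟨⟨x, hx⟩, rfl, h⟩

lemma add_mem_graph {S T : E →ₗ.[R] F} {x : E} {y z : F} (hS : (x, y) ∈ S.graph)
    (hT : (x, z) ∈ T.graph) : (x, y + z) ∈ (S + T).graph := by
  obtain ⟨h1, h2⟩ := exists_apply_eq_of_mem_graph hS
  obtain ⟨h3, h4⟩ := exists_apply_eq_of_mem_graph hT
  refine mem_graph_of_apply_eq (T := S + T) ⟨h1, h3⟩ ?_
  rw [← h2, ← h4]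
  exact LinearPMap.add_apply S T ⟨x, h1, h3⟩

lemma vadd_mem_graph {A : E →ₗ[R] F} {T : E →ₗ.[R] F} {x : E} {z : F}
    (hT : (x, z) ∈ T.graph) : (x, A x + z) ∈ (A +ᵥ T).graph := by
  obtain ⟨h3, h4⟩ := exists_apply_eq_of_mem_graph hT
  refine mem_graph_of_apply_eq (T := A +ᵥ T) h3 ?_
  rw [← h4]
  exact LinearPMap.vadd_apply A T ⟨x, h3⟩

lemma zero_mem_graph (x : E) : (x, (0 : F)) ∈ (0 : E →ₗ.[R] F).graph :=
  mem_graph_of_apply_eq (T := (0 : E →ₗ.[R] F)) Submodule.mem_top rfl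

lemma sum_mem_graph {ι : Type*} {s : Finset ι} {T : ι → E →ₗ.[R] F} {x : E} {y : ι → F}
    (h : ∀ i ∈ s, (x, y i) ∈ (T i).graph) : (x, ∑ i ∈ s, y i) ∈ (∑ i ∈ s, T i).graph := by
  classical
  induction s using Finset.induction_on with
  | empty => exact zero_mem_graph x
  | insert i s hi ih =>
    rw [Finset.sum_insert hi, Finset.sum_insert hi]
    exact add_mem_graph (h i (Finset.mem_insert_self i s))
      (ih fun j hj => h j (Finset.mem_insert_of_mem hj))

lemma const_smul_mem_graph {V W : Type*} [AddCommGroup V] [Module ℂ V] [AddCommGroup W]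
    [Module ℂ W] (c : ℂ) {T : V →ₗ.[ℂ] W} {x : V} {z : W} (hT : (x, z) ∈ T.graph) :
    (x, c • z) ∈ (c • T).graph := by
  obtain ⟨h3, h4⟩ := exists_apply_eq_of_mem_graph hT
  refine mem_graph_of_apply_eq (T := c • T) h3 ?_
  rw [← h4]
  exact LinearPMap.smul_apply c T ⟨x, h3⟩

end LinearPMap

namespace SpinPhoton

lemma tmul_mem_graph_tensorOp {N : ℕ} {A : Fock →ₗ.[ℂ] Fock} {Ψ Φ : Fock}
    (h : (Ψ, Φ) ∈ A.graph) (S : SpinMat N) (v : SpinSpace N) :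
    (Ψ ⊗ₜ[ℂ] v, Φ ⊗ₜ[ℂ] Matrix.toEuclideanLin S v) ∈ (tensorOp A S).graph := by
  obtain ⟨h1, h2⟩ := LinearPMap.exists_apply_eq_of_mem_graph h
  rw [tensorOp, Submodule.toLinearPMap_graph_eq _ (tensorOpGraph_functional A S)]
  refine ⟨(⟨Ψ, h1⟩ : A.domain) ⊗ₜ[ℂ] v, ?_⟩
  rw [← h2]
  rfl

/-! ### Spins -/

lemma toEuclideanLin_apply_coord {ι : Type*} [Fintype ι] [DecidableEq ι] (A : Matrix ι ι ℂ)
    (v : EuclideanSpace ℂ ι) (s : ι) :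
    Matrix.toEuclideanLin A v s = ∑ t, A s t * v t := by
  simp [Matrix.toLpLin_apply, Matrix.mulVec, dotProduct]

lemma kron_tprodVec {N : ℕ} (A : Fin N → Matrix (Fin 2) (Fin 2) ℂ)
    (v : Fin N → EuclideanSpace ℂ (Fin 2)) :
    Matrix.toEuclideanLin (kron A) (tprodVec v) =
      tprodVec fun μ => Matrix.toEuclideanLin (A μ) (v μ) := by
  ext s
  rw [toEuclideanLin_apply_coord]
  simp only [tprodVec, toEuclideanLin_apply_coord, kron, Matrix.of_apply]
  rw [Finset.prod_univ_sum, Fintype.piFinset_univ]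
  simp_rw [Finset.prod_mul_distrib]

lemma tprodVec_update_apply {N : ℕ} (v : Fin N → EuclideanSpace ℂ (Fin 2)) (l : Fin N)
    (w : EuclideanSpace ℂ (Fin 2)) (s : Fin N → Fin 2) :
    tprodVec (Function.update v l w) s =
      w (s l) * ∏ μ ∈ Finset.univ.erase l, v μ (s μ) := by
  simp only [tprodVec]
  rw [← Finset.mul_prod_erase _ _ (Finset.mem_univ l), Function.update_self]
  congr 1
  exact Finset.prod_congr rfl fun μ hμ => by
    rw [Function.update_of_ne (Finset.ne_of_mem_erase hμ)]

lemma sigma_tprodVec {N : ℕ} (v : Fin N → EuclideanSpace ℂ (Fin 2)) (l : Fin N) (m : Fin 3) :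
    Matrix.toEuclideanLin (sigma l m) (tprodVec v) =
      tprodVec (Function.update v l (Matrix.toEuclideanLin (pauli m) (v l))) := by
  rw [sigma, kron_tprodVec]
  congr 1
  funext μ
  by_cases hμ : μ = l
  · subst hμ
    simp
  · rw [Function.update_of_ne hμ, Function.update_of_ne hμ]
    ext i
    rw [toEuclideanLin_apply_coord]
    simp [Matrix.one_apply]

/-- The operators act on the `l`-th factor alone, so by multilinearity an eigenvector in that factor
suffices. -/
lemma sum_sigma_tprodVec {N : ℕ} (v : Fin N → EuclideanSpace ℂ (Fin 2)) (l : Fin N)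
    (β : Fin 3 → ℂ) {z : ℂ}
    (hz : Matrix.toEuclideanLin (∑ m, β m • pauli m) (v l) = z • v l) :
    ∑ m, β m • Matrix.toEuclideanLin (sigma l m) (tprodVec v) = z • tprodVec v := by
  simp_rw [sigma_tprodVec]
  have h1 : z • tprodVec v = tprodVec (Function.update v l (z • v l)) := by
    ext s
    rw [PiLp.smul_apply, ← Function.update_eq_self l v, tprodVec_update_apply,
      Function.update_eq_self, tprodVec_update_apply]
    simp [mul_assoc]
  rw [h1, ← hz]
  ext s
  rw [tprodVec_update_apply, map_sum]
  simp only [map_smul, LinearMap.sum_apply, LinearMap.smul_apply, WithLp.ofLp_sum,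
    WithLp.ofLp_smul, Finset.sum_apply, Pi.smul_apply, smul_eq_mul, tprodVec_update_apply,
    Finset.sum_mul, mul_assoc]

lemma norm_tprodVec {N : ℕ} (v : Fin N → EuclideanSpace ℂ (Fin 2)) :
    ‖tprodVec v‖ = ∏ μ, ‖v μ‖ := by
  have h : ‖tprodVec v‖ ^ 2 = (∏ μ, ‖v μ‖) ^ 2 := by
    rw [EuclideanSpace.norm_sq_eq, ← Finset.prod_pow]
    simp_rw [EuclideanSpace.norm_sq_eq]
    rw [Finset.prod_univ_sum, Fintype.piFinset_univ]
    simp [tprodVec, Finset.prod_pow]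
  exact (pow_left_inj₀ (norm_nonneg _) (Finset.prod_nonneg fun μ _ => norm_nonneg _)
    two_ne_zero).1 h

lemma norm_spinState {N : ℕ} {b₀ b₁ : EuclideanSpace ℂ (Fin 2)} (h₀ : ‖b₀‖ = 1) (h₁ : ‖b₁‖ = 1)
    (E : Finset (Fin N)) : ‖spinState b₀ b₁ E‖ = 1 := by
  rw [spinState, norm_tprodVec]
  exact Finset.prod_eq_one fun μ _ => by split_ifs <;> assumption

lemma sum_sigma_spinState {N : ℕ} {b₀ b₁ : EuclideanSpace ℂ (Fin 2)} {β : Fin 3 → ℂ} {r : ℝ}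
    (h₀ : Matrix.toEuclideanLin (∑ m, β m • pauli m) b₀ = -(r : ℂ) • b₀)
    (h₁ : Matrix.toEuclideanLin (∑ m, β m • pauli m) b₁ = (r : ℂ) • b₁) (E : Finset (Fin N)) :
    ∑ l, ∑ m, β m • Matrix.toEuclideanLin (sigma l m) (spinState b₀ b₁ E) =
      (((2 * (E.card : ℝ) - N) * r : ℝ) : ℂ) • spinState b₀ b₁ E := by
  -- The scalar `2·1_E(l) - 1` is the sign of the spin at `l`; its sum over `l` is `2|E| - N`.
  have h2 : ∀ l : Fin N, ∑ m, β m • Matrix.toEuclideanLin (sigma l m) (spinState b₀ b₁ E) =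
      ((2 * (if l ∈ E then 1 else 0) - 1) * (r : ℂ)) • spinState b₀ b₁ E := by
    intro l
    apply sum_sigma_tprodVec
    split_ifs
    · rw [h₁]
      congr 1
      ring
    · rw [h₀]
      congr 1
      ring
  simp_rw [h2]
  rw [← Finset.sum_smul, ← Finset.sum_mul, Finset.sum_sub_distrib, ← Finset.mul_sum]
  congr 1
  simp

/-- The operator norm of `σ_m^{[l]}`. -/
def sigmaNorm {N : ℕ} (l : Fin N) (m : Fin 3) : ℝ :=
  ‖LinearMap.toContinuousLinearMap (Matrix.toEuclideanLin (sigma l m))‖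

lemma sigmaNorm_nonneg {N : ℕ} (l : Fin N) (m : Fin 3) : 0 ≤ sigmaNorm l m := norm_nonneg _

lemma norm_sigma_apply_le {N : ℕ} (l : Fin N) (m : Fin 3) {v : SpinSpace N} (hv : ‖v‖ = 1) :
    ‖Matrix.toEuclideanLin (sigma l m) v‖ ≤ sigmaNorm l m := by
  have h := (LinearMap.toContinuousLinearMap (Matrix.toEuclideanLin (sigma l m))).le_opNorm v
  rwa [hv, mul_one] at h

/-- The expectation is real since `sigma l m` is Hermitian, and the factors `i⁻¹` and `i` cancel. -/
lemma piForm_iSigma {N : ℕ} (a : SpinSpace N) (l : Fin N) (m : Fin 3) :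
    ((piForm a (iSigma l m) : ℝ) : ℂ) = expect (sigma l m) a := by
  have h1 : (Matrix.toEuclideanLin (sigma l m) : SpinSpace N →ₗ[ℂ] SpinSpace N).IsSymmetric :=
    Matrix.isSymmetric_toEuclideanLin_iff.2 (sigma_conjTranspose l m)
  have h2 : (starRingEnd ℂ) (expect (sigma l m) a) = expect (sigma l m) a := by
    rw [expect, inner_conj_symm]
    exact h1 a a
  have h3 : expect ((iSigma l m : suLie N) : SpinMat N) a =
      Complex.I * expect (sigma l m) a := by
    simp only [expect, iSigma, map_smul, LinearMap.smul_apply, inner_smul_right]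
  have h4 : piForm a (iSigma l m) = (expect (sigma l m) a).re := by
    change (Complex.I⁻¹ * expect ((iSigma l m : suLie N) : SpinMat N) a).re = _
    rw [h3, inv_mul_cancel_left₀ Complex.I_ne_zero]
  rw [h4]
  exact Complex.conj_eq_iff_re.1 h2

lemma abs_piForm_iSigma_le {N : ℕ} {a : SpinSpace N} (ha : ‖a‖ = 1) (l : Fin N) (m : Fin 3) :
    |piForm a (iSigma l m)| ≤ sigmaNorm l m := by
  rw [← Real.norm_eq_abs, ← Complex.norm_real, piForm_iSigma, expect]
  refine (norm_inner_le_norm _ _).trans ?_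
  rw [ha, one_mul]
  exact norm_sigma_apply_le l m ha

/-! ### Action of the Hamiltonians on coherent states -/

lemma div_sqrt_two_mul {h : ℝ} (hh : 0 < h) :
    h / Real.sqrt (2 * h) = Real.sqrt h / Real.sqrt 2 := by
  have h1 : Real.sqrt h ^ 2 = h := Real.sq_sqrt hh.le
  have h2 : 0 < Real.sqrt h := Real.sqrt_pos.2 hh
  rw [Real.sqrt_mul (by norm_num)]
  nth_rewrite 1 [← h1]
  field_simp

lemma sqrt_div_sqrt_two_div {h : ℝ} (hh : 0 < h) :
    Real.sqrt h / Real.sqrt 2 / Real.sqrt (2 * h) = 1 / 2 := by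
  have h1 : Real.sqrt 2 ^ 2 = 2 := Real.sq_sqrt (by norm_num)
  have h2 : 0 < Real.sqrt h := Real.sqrt_pos.2 hh
  rw [Real.sqrt_mul (by norm_num)]
  field_simp
  rw [h1]

/-- Linearity of `a*` in its argument turns `a*(Mf)` into a combination of the `a*(g_{l,m})`, with
the constant `√h / √2` that `weylOp` carries. -/
lemma IsStationaryPoint.mem_graph_photonHam {N : ℕ} {h : ℝ} (hh : 0 < h) {χ : 𝓢(ℝ, ℝ)}
    {x : Fin N → R3} {β : R3} {q p : HReal} {ω : Module.Dual ℝ (suLie N)}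
    (hst : IsStationaryPoint h χ x β q p ω) :
    (coherent h hh q p, -((h * (Real.sqrt h / Real.sqrt 2) : ℝ) : ℂ) •
      ∑ l, ∑ m, (ω (iSigma l m) : ℂ) • creationCoherent h hh q p (fieldCplx χ (x l) m)) ∈
      (photonHam h).graph := by
  obtain ⟨hq, hp⟩ := hst.mem_freqMulGraph
  have h1 := coherent_mem_dGammaGraph hh hq hp
  rw [cplx_smul_sum_field χ x (-h) (fun l m => ω (iSigma l m))] at h1
  simp only [map_smul, map_sum] at h1
  rw [← Submodule.toLinearPMap_graph_eq _ dGammaGraph_functional] at h1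
  have h2 := LinearPMap.const_smul_mem_graph (h : ℂ) h1
  rw [smul_smul, smul_smul] at h2
  have h3 : (h : ℂ) * ((Real.sqrt (2 * h) : ℝ) : ℂ)⁻¹ * ((-h : ℝ) : ℂ) =
      -((h * (Real.sqrt h / Real.sqrt 2) : ℝ) : ℂ) := by
    rw [← div_sqrt_two_mul hh]
    push_cast
    ring
  rw [h3] at h2
  exact h2

/-- The annihilation half acts as the scalar `⟨g, f⟩/2`, the creation half remains a vector. -/
lemma mem_graph_totalMagOp {h : ℝ} (hh : 0 < h) (χ : 𝓢(ℝ, ℝ)) (β x : R3) (m : Fin 3)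
    (q p : HReal) :
    (coherent h hh q p, ((β m : ℂ) + inner ℂ (fieldCplx χ x m) (cplx q p) / 2) •
      coherent h hh q p + ((Real.sqrt h / Real.sqrt 2 : ℝ) : ℂ) •
        creationCoherent h hh q p (fieldCplx χ x m)) ∈ (totalMagOp h χ β x m).graph := by
  have h1 := coherent_mem_fieldGraph hh q p (fieldCplx χ x m)
  rw [← Submodule.toLinearPMap_graph_eq _ (fieldGraph_functional (fieldCplx χ x m))] at h1
  have h2 := LinearPMap.vadd_mem_graph (A := (β m : ℂ) • (LinearMap.id : Fock →ₗ[ℂ] Fock))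
    (LinearPMap.const_smul_mem_graph ((Real.sqrt h / Real.sqrt 2 : ℝ) : ℂ) h1)
  have h3 : ((Real.sqrt h / Real.sqrt 2 : ℝ) : ℂ) * (inner ℂ (fieldCplx χ x m) (cplx q p) /
      ((Real.sqrt (2 * h) : ℝ) : ℂ)) = inner ℂ (fieldCplx χ x m) (cplx q p) / 2 := by
    rw [mul_div_left_comm, ← Complex.ofReal_div, sqrt_div_sqrt_two_div hh]
    push_cast
    ring
  rw [smul_add, smul_smul, h3, ← add_assoc, LinearMap.smul_apply, LinearMap.id_apply,
    ← add_smul] at h2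
  exact h2

lemma reducedHam_coherent {N : ℕ} {h : ℝ} (hh : 0 < h) {χ : 𝓢(ℝ, ℝ)} {x : Fin N → R3} {β : R3}
    {q p : HReal} {a : SpinSpace N} (hst : IsStationaryPoint h χ x β q p (piForm a)) :
    (coherent h hh q p, (classicalHam h χ x β q p (piForm a) : ℂ) • coherent h hh q p) ∈
      (reducedHam h χ x β a).graph := by
  have h1 := LinearPMap.add_mem_graph (hst.mem_graph_photonHam hh)
    (LinearPMap.const_smul_mem_graph (h : ℂ)
      (LinearPMap.sum_mem_graph (s := Finset.univ) fun l _ =>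
        LinearPMap.sum_mem_graph (s := Finset.univ) fun m _ =>
          LinearPMap.const_smul_mem_graph (expect (sigma l m) a)
            (mem_graph_totalMagOp hh χ β (x l) m q p)))
  rw [reducedHam]
  convert h1 using 2
  have h2 := hst.sum_inner_field
  rw [hst.classicalHam_eq]
  simp_rw [← piForm_iSigma, smul_add, Finset.sum_add_distrib, smul_smul, ← Finset.sum_smul]
  set Ψ := coherent h hh q p
  set r := Real.sqrt h / Real.sqrt 2
  have h3 : ∑ l, ∑ m, ((piForm a (iSigma l m) : ℂ) * (r : ℂ)) •
        creationCoherent h hh q p (fieldCplx χ (x l) m) =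
      (r : ℂ) • ∑ l, ∑ m, (piForm a (iSigma l m) : ℂ) •
        creationCoherent h hh q p (fieldCplx χ (x l) m) := by
    simp_rw [Finset.smul_sum, smul_smul, mul_comm]
  have h4 : (h : ℂ) * ∑ l, ∑ m, (piForm a (iSigma l m) : ℂ) *
        ((β m : ℂ) + inner ℂ (fieldCplx χ (x l) m) (cplx q p) / 2) =
      ((h * ∑ l, ∑ m, piForm a (iSigma l m) * β m - photonEnergy q p : ℝ) : ℂ) := by
    simp_rw [mul_add, Finset.sum_add_distrib, mul_div_assoc', ← Finset.sum_div]
    push_cast at h2 ⊢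
    -- Half of `-2 H_ph(q,p)` is the `-H_ph(q,p)` in `classicalHam_eq`.
    linear_combination h2 / 2
  rw [h3, ← h4, Complex.ofReal_mul]
  -- The creation terms from the photon energy and from the interaction have opposite coefficients.
  module

/-! ### Estimates -/

lemma exists_norm_le_of_isStationaryPoint {N : ℕ} (χ : 𝓢(ℝ, ℝ)) (x : Fin N → R3) :
    ∃ T : ℝ, ∀ (h : ℝ), 0 < h → ∀ (β : R3) (q p : HReal) (a : SpinSpace N), ‖a‖ = 1 →
      IsStationaryPoint h χ x β q p (piForm a) → ‖q‖ ≤ h * T ∧ ‖p‖ ≤ h * T := by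
  choose u hu using fun (l : Fin N) m => exists_mem_freqMulGraph_fieldA χ (x l) m
  choose v hv using fun (l : Fin N) m => exists_mem_freqMulGraph_fieldB χ (x l) m
  -- The preimages of the form factors under `M` are chosen before `h`, `β` and `a`, and `|ω_{l,m}|`
  -- is at most `sigmaNorm l m`; hence `T` depends on `χ` and `x` only.
  refine ⟨max (∑ l, ∑ m, sigmaNorm l m * ‖u l m‖) (∑ l, ∑ m, sigmaNorm l m * ‖v l m‖),
    fun h hh β q p a ha hst => ?_⟩
  obtain ⟨hq, hp⟩ := hst.mem_freqMulGraph
  have hc := abs_piForm_iSigma_le ha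
  constructor
  · rw [freqMulGraph_eq_sum hu hq, norm_smul, norm_neg, Real.norm_of_nonneg hh.le]
    gcongr
    exact (norm_sum_smul_le hc u).trans (le_max_left _ _)
  · rw [freqMulGraph_eq_sum hv hp, norm_smul, norm_neg, Real.norm_of_nonneg hh.le]
    gcongr
    exact (norm_sum_smul_le hc v).trans (le_max_right _ _)

/-- Since `f = O(h)`, the mean photon number is even `O(h)`; a bound uniform on `(0, h₀]` is enough.
-/
lemma norm_cplx_div_le {h h₀ T : ℝ} (hh : 0 < h) (hh₀ : h ≤ h₀) {q p : HReal}
    (hq : ‖q‖ ≤ h * T) (hp : ‖p‖ ≤ h * T) :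
    ‖cplx q p‖ ^ 2 / (2 * h) ≤ h₀ * T ^ 2 := by
  rw [norm_cplx_sq, div_le_iff₀ (by positivity)]
  calc ‖q‖ ^ 2 + ‖p‖ ^ 2 ≤ (h * T) ^ 2 + (h * T) ^ 2 := by gcongr
    _ = h * T ^ 2 * (2 * h) := by ring
    _ ≤ h₀ * T ^ 2 * (2 * h) := by gcongr

lemma norm_creationCoherent_le_of_le {h h₀ T : ℝ} (hh : 0 < h) {q p : HReal}
    (hf : ‖cplx q p‖ ^ 2 / (2 * h) ≤ h₀ * T ^ 2) (g : Lp C3 2 (volume : Measure R3)) :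
    ‖creationCoherent h hh q p g‖ ≤ ‖g‖ * (‖vac‖ * Real.sqrt (1 + h₀ * T ^ 2)) := by
  refine (norm_creationCoherent_le hh q p g).trans ?_
  rw [mul_assoc]
  gcongr

/-- Writing `‖f‖ = √(2h) · (‖f‖ / √(2h))` extracts the same factor `√h / √2` that the creation terms
carry. -/
lemma norm_inner_div_two_smul_coherent_le {h h₀ T : ℝ} (hh : 0 < h) {q p : HReal}
    (hf : ‖cplx q p‖ ^ 2 / (2 * h) ≤ h₀ * T ^ 2) (g : Lp C3 2 (volume : Measure R3)) :
    ‖(inner ℂ g (cplx q p) / 2) • coherent h hh q p‖ ≤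
      (Real.sqrt h / Real.sqrt 2) * (‖g‖ * (‖vac‖ * Real.sqrt (1 + h₀ * T ^ 2))) := by
  have h1 : 0 < Real.sqrt (2 * h) := Real.sqrt_pos.2 (by positivity)
  have h2 : ‖cplx q p‖ / Real.sqrt (2 * h) ≤ Real.sqrt (1 + h₀ * T ^ 2) := by
    apply Real.le_sqrt_of_sq_le
    rw [div_pow, Real.sq_sqrt (by positivity)]
    linarith
  rw [norm_smul, norm_div, Complex.norm_ofNat]
  calc ‖inner ℂ g (cplx q p)‖ / 2 * ‖coherent h hh q p‖ ≤ ‖g‖ * ‖cplx q p‖ / 2 * ‖vac‖ := by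
        gcongr
        · exact norm_inner_le_norm _ _
        · exact norm_coherent_le hh q p
    _ = (Real.sqrt h / Real.sqrt 2) * (‖g‖ * (‖vac‖ * (‖cplx q p‖ / Real.sqrt (2 * h)))) := by
        have h3 := sqrt_div_sqrt_two_div hh
        rw [div_eq_iff h1.ne'] at h3
        rw [h3]
        field_simp
    _ ≤ _ := by gcongr

/-! ### The remainder on product states and its size -/

/-- The remainder `(H(h) - (2|E| - N)|β|h) (Ψ ⊗ v)`, for a coherent state `Ψ` and a joint
eigenvector `v` of the operators `∑ₘ βₘ σₘ^{[l]}`. -/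
def spinRemainder {N : ℕ} (h : ℝ) (hh : 0 < h) (χ : 𝓢(ℝ, ℝ)) (x : Fin N → R3) (q p : HReal)
    (c : Fin N → Fin 3 → ℝ) (v : SpinSpace N) : TotalSpace N :=
  (-((h * (Real.sqrt h / Real.sqrt 2) : ℝ) : ℂ) •
      ∑ l, ∑ m, (c l m : ℂ) • creationCoherent h hh q p (fieldCplx χ (x l) m)) ⊗ₜ[ℂ] v +
    (h : ℂ) • ∑ l, ∑ m, ((inner ℂ (fieldCplx χ (x l) m) (cplx q p) / 2) • coherent h hh q p +
      ((Real.sqrt h / Real.sqrt 2 : ℝ) : ℂ) •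
        creationCoherent h hh q p (fieldCplx χ (x l) m)) ⊗ₜ[ℂ]
          Matrix.toEuclideanLin (sigma l m) v

/-- Splitting off the `β` part leaves only field terms. The spin vector here is unrelated to the one
defining `ω`, so no cancellation is expected, only smallness. -/
lemma quantumHam_coherent_tmul {N : ℕ} {h : ℝ} (hh : 0 < h) {χ : 𝓢(ℝ, ℝ)} {x : Fin N → R3}
    {β : R3} {q p : HReal} {ω : Module.Dual ℝ (suLie N)}
    (hst : IsStationaryPoint h χ x β q p ω) {v : SpinSpace N} {z : ℂ}
    (hv : ∑ l, ∑ m, (β m : ℂ) • Matrix.toEuclideanLin (sigma l m) v = z • v) :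
    (coherent h hh q p ⊗ₜ[ℂ] v, ((h : ℂ) * z) • (coherent h hh q p ⊗ₜ[ℂ] v) +
      spinRemainder h hh χ x q p (fun l m => ω (iSigma l m)) v) ∈
        (quantumHam h χ x β).graph := by
  have h1 := LinearPMap.add_mem_graph
    (tmul_mem_graph_tensorOp (hst.mem_graph_photonHam hh) 1 v)
    (LinearPMap.const_smul_mem_graph (h : ℂ)
      (LinearPMap.sum_mem_graph (s := Finset.univ) fun l _ =>
        LinearPMap.sum_mem_graph (s := Finset.univ) fun m _ =>
          tmul_mem_graph_tensorOp (mem_graph_totalMagOp hh χ β (x l) m q p) (sigma l m) v))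
  rw [quantumHam]
  convert h1 using 2
  have h2 : Matrix.toEuclideanLin (1 : SpinMat N) v = v := by
    ext s
    rw [toEuclideanLin_apply_coord]
    simp [Matrix.one_apply]
  have h3 : ∀ l m, (((β m : ℂ) + inner ℂ (fieldCplx χ (x l) m) (cplx q p) / 2) •
      coherent h hh q p + ((Real.sqrt h / Real.sqrt 2 : ℝ) : ℂ) •
        creationCoherent h hh q p (fieldCplx χ (x l) m)) ⊗ₜ[ℂ]
          Matrix.toEuclideanLin (sigma l m) v =
      coherent h hh q p ⊗ₜ[ℂ] ((β m : ℂ) • Matrix.toEuclideanLin (sigma l m) v) +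
      ((inner ℂ (fieldCplx χ (x l) m) (cplx q p) / 2) • coherent h hh q p +
      ((Real.sqrt h / Real.sqrt 2 : ℝ) : ℂ) •
        creationCoherent h hh q p (fieldCplx χ (x l) m)) ⊗ₜ[ℂ]
          Matrix.toEuclideanLin (sigma l m) v := by
    intro l m
    rw [← TensorProduct.smul_tmul, ← TensorProduct.add_tmul, add_smul, add_assoc]
  simp_rw [h3, Finset.sum_add_distrib, ← TensorProduct.tmul_sum]
  rw [hv, h2, smul_add, TensorProduct.tmul_smul, smul_smul, spinRemainder]
  abel

lemma TotalSpace.norm_smul {N : ℕ} (z : ℂ) (w : TotalSpace N) : ‖z • w‖ = ‖z‖ * ‖w‖ :=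
  @_root_.norm_smul ℂ (TotalSpace N) _ _ _ NormedSpace.toNormSMulClass z w

lemma norm_spinRemainder_le {N : ℕ} {h h₀ T : ℝ} (hh : 0 < h) (χ : 𝓢(ℝ, ℝ)) (x : Fin N → R3)
    {q p : HReal} (hf : ‖cplx q p‖ ^ 2 / (2 * h) ≤ h₀ * T ^ 2) {c : Fin N → Fin 3 → ℝ}
    (hc : ∀ l m, |c l m| ≤ sigmaNorm l m) {v : SpinSpace N} (hv : ‖v‖ = 1) :
    ‖spinRemainder h hh χ x q p c v‖ ≤ h * (Real.sqrt h / Real.sqrt 2) *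
      (3 * ∑ l, ∑ m, sigmaNorm l m *
        -- The `3` counts one unit from the photon energy and one from each of the annihilation and
        -- creation halves.
        (‖fieldCplx χ (x l) m‖ * (‖vac‖ * Real.sqrt (1 + h₀ * T ^ 2)))) := by
  set R := ‖vac‖ * Real.sqrt (1 + h₀ * T ^ 2)
  set r := Real.sqrt h / Real.sqrt 2
  have hr : 0 ≤ r := by positivity
  set S := ∑ l, ∑ m, sigmaNorm l m * (‖fieldCplx χ (x l) m‖ * R)
  have h1 : ‖∑ l, ∑ m, (c l m : ℂ) • creationCoherent h hh q p (fieldCplx χ (x l) m)‖ ≤ S := by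
    refine (norm_sum_le _ _).trans (Finset.sum_le_sum fun l _ => ?_)
    refine (norm_sum_le _ _).trans (Finset.sum_le_sum fun m _ => ?_)
    rw [norm_smul, Complex.norm_real, Real.norm_eq_abs]
    exact mul_le_mul (hc l m) (norm_creationCoherent_le_of_le hh hf _) (norm_nonneg _)
      (sigmaNorm_nonneg l m)
  have h2 : ‖∑ l, ∑ m, ((inner ℂ (fieldCplx χ (x l) m) (cplx q p) / 2) • coherent h hh q p +
      (r : ℂ) • creationCoherent h hh q p (fieldCplx χ (x l) m)) ⊗ₜ[ℂ]
          Matrix.toEuclideanLin (sigma l m) v‖ ≤ 2 * r * S := by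
    rw [Finset.mul_sum]
    refine (norm_sum_le (E := TotalSpace N) _ _).trans (Finset.sum_le_sum fun l _ => ?_)
    rw [Finset.mul_sum]
    refine (norm_sum_le (E := TotalSpace N) _ _).trans (Finset.sum_le_sum fun m _ => ?_)
    rw [TensorProduct.norm_tmul]
    calc _ ≤ (r * (‖fieldCplx χ (x l) m‖ * R) + r * (‖fieldCplx χ (x l) m‖ * R)) *
          sigmaNorm l m := by
          refine mul_le_mul ((norm_add_le _ _).trans (add_le_add
            (norm_inner_div_two_smul_coherent_le hh hf _) ?_)) (norm_sigma_apply_le l m hv)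
            (norm_nonneg _) (by positivity)
          rw [norm_smul, Complex.norm_real, Real.norm_of_nonneg hr]
          exact mul_le_mul_of_nonneg_left (norm_creationCoherent_le_of_le hh hf _) hr
      _ = _ := by ring
  rw [spinRemainder]
  refine (norm_add_le (E := TotalSpace N) _ _).trans ?_
  rw [TensorProduct.norm_tmul, hv, mul_one, TotalSpace.norm_smul, norm_smul, norm_neg, Complex.norm_real,
    Complex.norm_real, Real.norm_of_nonneg hh.le, Real.norm_of_nonneg (mul_nonneg hh.le hr)]
  calc h * r * _ + h * _ ≤ h * r * S + h * (2 * r * S) := by gcongr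
    _ = _ := by ring

lemma mul_sqrt_div_sqrt_two_le {h : ℝ} (hh : 0 < h) :
    h * (Real.sqrt h / Real.sqrt 2) ≤ h ^ (3 / 2 : ℝ) := by
  have h1 : h ^ (3 / 2 : ℝ) = h * Real.sqrt h := by
    rw [Real.sqrt_eq_rpow]
    nth_rewrite 2 [← Real.rpow_one h]
    rw [← Real.rpow_add hh]
    norm_num
  rw [h1]
  gcongr
  exact div_le_self (Real.sqrt_nonneg h) (Real.one_le_sqrt.2 (by norm_num))

lemma exists_quantumHam_bound {N : ℕ} (χ : 𝓢(ℝ, ℝ)) (x : Fin N → R3) (β : R3) (h₀ : ℝ)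
    (hh₀ : 0 < h₀) :
    ∃ C : ℝ, 0 < C ∧ ∀ b₀ b₁ : EuclideanSpace ℂ (Fin 2), ‖b₀‖ = 1 → ‖b₁‖ = 1 →
      Matrix.toEuclideanLin (∑ m, (β m : ℂ) • pauli m) b₀ = -(‖β‖ : ℂ) • b₀ →
      Matrix.toEuclideanLin (∑ m, (β m : ℂ) • pauli m) b₁ = (‖β‖ : ℂ) • b₁ →
      ∀ (h : ℝ) (hh : 0 < h), h ≤ h₀ →
      ∀ (q p : HReal) (a : SpinSpace N), ‖a‖ = 1 →
      IsStationaryPoint h χ x β q p (piForm a) →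
      ∀ E : Finset (Fin N),
      ∃ hdom : coherent h hh q p ⊗ₜ[ℂ] spinState b₀ b₁ E ∈ (quantumHam h χ x β).domain,
        ‖quantumHam h χ x β ⟨coherent h hh q p ⊗ₜ[ℂ] spinState b₀ b₁ E, hdom⟩ -
          (((2 * (E.card : ℝ) - N) * ‖β‖ * h : ℝ) : ℂ) •
            (coherent h hh q p ⊗ₜ[ℂ] spinState b₀ b₁ E)‖ ≤ C * h ^ (3 / 2 : ℝ) := by
  obtain ⟨T, hT⟩ := exists_norm_le_of_isStationaryPoint χ x
  have hS : 0 ≤ 3 * ∑ l, ∑ m, sigmaNorm l m *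
      (‖fieldCplx χ (x l) m‖ * (‖vac‖ * Real.sqrt (1 + h₀ * T ^ 2))) := by
    refine mul_nonneg (by norm_num) (Finset.sum_nonneg fun l _ => Finset.sum_nonneg fun m _ => ?_)
    have := sigmaNorm_nonneg l m
    positivity
  -- Adding `1` keeps the constant positive when the sum vanishes, as for `N = 0`.
  refine ⟨_, add_pos_of_nonneg_of_pos hS one_pos, ?_⟩
  intro b₀ b₁ hb₀ hb₁ he₀ he₁ h hh hle q p a ha hst E
  obtain ⟨hq, hp⟩ := hT h hh β q p a ha hst
  have hf := norm_cplx_div_le hh hle hq hp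
  obtain ⟨hdom, heq⟩ := LinearPMap.exists_apply_eq_of_mem_graph
    (quantumHam_coherent_tmul hh hst (sum_sigma_spinState he₀ he₁ E))
  refine ⟨hdom, ?_⟩
  have h1 : (h : ℂ) * (((2 * (E.card : ℝ) - N) * ‖β‖ : ℝ) : ℂ) =
      (((2 * (E.card : ℝ) - N) * ‖β‖ * h : ℝ) : ℂ) := by
    push_cast
    ring
  rw [heq, h1, add_sub_cancel_left]
  refine (norm_spinRemainder_le hh χ x hf (abs_piForm_iSigma_le ha)
    (norm_spinState hb₀ hb₁ E)).trans ?_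
  rw [mul_comm]
  have h2 := mul_sqrt_div_sqrt_two_le hh
  have h3 : (0 : ℝ) ≤ h ^ (3 / 2 : ℝ) := by positivity
  exact (mul_le_mul_of_nonneg_left h2 hS).trans (by linarith)

end SpinPhoton

end

open SpinPhoton in
theorem proposition6p4 {N : ℕ} (χ : 𝓢(ℝ, ℝ)) (x : Fin N → R3) (β : R3) :
    (∀ (h : ℝ) (hh : 0 < h) (q p : HReal) (a : SpinSpace N), ‖a‖ = 1 →
      IsStationaryPoint h χ x β q p (piForm a) →
      coherent h hh q p ≠ 0 ∧
      ∃ hdom : coherent h hh q p ∈ (reducedHam h χ x β a).domain,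
        reducedHam h χ x β a ⟨coherent h hh q p, hdom⟩ =
          (classicalHam h χ x β q p (piForm a) : ℂ) • coherent h hh q p) ∧
    (β ≠ 0 → ∀ h₀ : ℝ, 0 < h₀ → ∃ C : ℝ, 0 < C ∧
      ∀ b₀ b₁ : EuclideanSpace ℂ (Fin 2), ‖b₀‖ = 1 → ‖b₁‖ = 1 →
      Matrix.toEuclideanLin (∑ m, (β m : ℂ) • pauli m) b₀ = -(‖β‖ : ℂ) • b₀ →
      Matrix.toEuclideanLin (∑ m, (β m : ℂ) • pauli m) b₁ = (‖β‖ : ℂ) • b₁ →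
      ∀ (h : ℝ) (hh : 0 < h), h ≤ h₀ →
      ∀ (q p : HReal) (a : SpinSpace N), ‖a‖ = 1 →
      IsStationaryPoint h χ x β q p (piForm a) →
      ∀ E : Finset (Fin N),
      ∃ hdom : coherent h hh q p ⊗ₜ[ℂ] spinState b₀ b₁ E ∈ (quantumHam h χ x β).domain,
        ‖quantumHam h χ x β ⟨coherent h hh q p ⊗ₜ[ℂ] spinState b₀ b₁ E, hdom⟩ -
          (((2 * (E.card : ℝ) - N) * ‖β‖ * h : ℝ) : ℂ) •
            (coherent h hh q p ⊗ₜ[ℂ] spinState b₀ b₁ E)‖ ≤ C * h ^ (3 / 2 : ℝ)) :=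
  ⟨fun _ hh q p _ _ hst => ⟨coherent_ne_zero hh q p,
    LinearPMap.exists_apply_eq_of_mem_graph (reducedHam_coherent hh hst)⟩,
    fun _ h₀ hh₀ => exists_quantumHam_bound χ x β h₀ hh₀⟩
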